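/- \textbf{Definitions.} Let $\Sigma$ be a finite alphabet with a linear order $\prec$. A \emph{Wheeler NFA} over $\Sigma$ is a nondeterministic finite automaton with state set $Q$, a unique initial state $s$, transition function $\delta\colon Q\times\Sigma\to\mathcal{P}(Q)$ and a set of final states $F\subseteq Q$, together with a linear order $<$ on $Q$ such that $s$ is the minimum of $(Q,<)$, $s$ has no incoming transitions, and for all $v_1\in\delta(u_1,a_1)$ and $v_2\in\delta(u_2,a_2)$: (i) if $a_1\prec a_2$, then $v_1<v_2$; (ii) if $a_1=a_2$ and $u_1<u_2$, then $v_1\le v_2$. A language $\mathcal{L}\subseteq\Sigma^*$ is \emph{Wheeler} if it is the language accepted by some Wheeler NFA over $\Sigma$ (in particular the empty language is Wheeler). An \emph{edge-labelled DFA} $\mathcal{A}$ consists of a finite set of states, a finite linearly ordered alphabet, an initial state, a set of final states and a partial transition function; it accepts the words that label a path from the initial state to a final state. It is given explicitly, by a binary word that lists the number of states, the number of letters, the initial state, the final states and the transition table; the states and the letters are numbered from $0$, the letters in increasing order, and the length of the word is polynomial in the numbers of states and letters. Both numbers are part of the input. \textbf{Theorem.} There is a deterministic Turing machine (with finitely many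 stacks) that, given an edge-labelled DFA $\mathcal{A}$, decides whether the regular language $\mathcal{L}(\mathcal{A})$ accepted by $\mathcal{A}$ is Wheeler, in a number of steps bounded by a polynomial in the length of the description of $\mathcal{A}$. -/

import Mathlib

/-- `IsWheelerNFA M s`: with respect to the given linear orders on the alphabet and on the states,
the nondeterministic automaton `M` with unique initial state `s` is a Wheeler automaton. -/
structure IsWheelerNFA {α Q : Type*} [LinearOrder α] [LinearOrder Q] (M : NFA α Q) (s : Q) :
    Prop where
  /-- `s` is the unique initial state. -/
  start_eq : M.start = {s}
  /-- `s` is the minimum of the order on the states. -/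
  start_le : ∀ q : Q, s ≤ q
  /-- `s` has no incoming transitions. -/
  start_notMem_step : ∀ (u : Q) (a : α), s ∉ M.step u a
  /-- First Wheeler property. -/
  lt_of_letter_lt : ∀ (u₁ u₂ v₁ v₂ : Q) (a₁ a₂ : α),
    v₁ ∈ M.step u₁ a₁ → v₂ ∈ M.step u₂ a₂ → a₁ < a₂ → v₁ < v₂
  /-- Second Wheeler property. -/
  le_of_source_lt : ∀ (u₁ u₂ v₁ v₂ : Q) (a₁ a₂ : α),
    v₁ ∈ M.step u₁ a₁ → v₂ ∈ M.step u₂ a₂ → a₁ = a₂ ∧ u₁ < u₂ → v₁ ≤ v₂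

/-- A language over a linearly ordered alphabet is Wheeler if it is accepted by some finite
Wheeler automaton. (Useless states of a Wheeler automaton can be deleted without losing the Wheeler
properties, so for a nonempty language it makes no difference whether all states are required to be
reachable and co-reachable. Without this requirement the empty language is Wheeler.) -/
def IsWheelerLanguage {α : Type*} [LinearOrder α] (L : Language α) : Prop :=
  ∃ (Q : Type) (_ : Finite Q) (_ : LinearOrder Q) (M : NFA α Q) (s : Q),
    IsWheelerNFA M s ∧ M.accepts = L

/-- A finite edge-labelled deterministic automaton with a partial transition function.
The states are `0, …, numStates - 1`, the alphabet is `0 < 1 < … < numLetters - 1`; both numbers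
are part of the data. -/
structure EdgeDFA where
  /-- Number of states. -/
  numStates : ℕ
  /-- Number of letters of the ordered alphabet. -/
  numLetters : ℕ
  /-- Initial state. -/
  start : Fin numStates
  /-- Partial transition function: `step q a = some r` if there is an edge from `q` to `r` labelled
  `a`, and `step q a = none` if no edge labelled `a` leaves `q`. -/
  step : Fin numStates → Fin numLetters → Option (Fin numStates)
  /-- Final states. -/
  accept : Fin numStates → Bool

namespace EdgeDFA

/-- The state reached from `q` by reading the word `w`, if there is one. -/
def run (A : EdgeDFA) : Fin A.numStates → List (Fin A.numLetters) → Option (Fin A.numStates)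
  | q, [] => some q
  | q, a :: w => (A.step q a).bind fun r => A.run r w

/-- The language accepted by `A`. -/
def language (A : EdgeDFA) : Language (Fin A.numLetters) :=
  {w | ∃ q, A.run A.start w = some q ∧ A.accept q = true}

/-- The description of `A` as a list of numbers: the number of states, the number of letters, the
initial state, one bit for each state saying whether it is final, and then the transition table row
by row, where an entry is `0` if the transition is undefined and `r + 1` if it leads to `r`. -/
def toList (A : EdgeDFA) : List ℕ :=
  [A.numStates, A.numLetters, (A.start : ℕ)] ++
    ((List.finRange A.numStates).map fun q => (A.accept q).toNat) ++
    (List.finRange A.numStates).flatMap fun q =>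
      (List.finRange A.numLetters).map fun a => (A.step q a).elim 0 fun r => (r : ℕ) + 1

/-- The binary word that describes `A`: each number `m` of its description is written as `m` ones
followed by a zero. No number exceeds the number of states or the number of letters, and the
description has at least that many entries (up to a constant), so the length of the word is
polynomially related to that of any other explicit description of the transition table. -/
def encode (A : EdgeDFA) : List Bool :=
  A.toList.flatMap fun m => List.replicate m true ++ [false]

end EdgeDFA

/-- The property `P` of the objects of type `α`, presented to a machine as words through `enc`, can
be decided in polynomial time: some deterministic multi-stack Turing machine outputs for every `x`
the truth value of `P x`, in a number of steps bounded by a polynomial in the length of `enc x`. -/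
def DecidableInPolyTime {α Γ : Type} (enc : α → List Γ) (P : α → Prop) : Prop :=
  ∃ f : α → Bool, (∀ x, f x = true ↔ P x) ∧
    Nonempty (Turing.TM2ComputableInPolyTime enc Computability.encodeBool f)

/-! The language of a deterministic automaton is Wheeler exactly when the automaton has no forbidden
pattern: two inequivalent live states `u`, `v` that carry cycles with a common label `γ` and are
reached from the initial state by words `μ`, `ν` on the same side of `γ` (`isWheelerLanguage_iff`).
All words are kept reversed, so that the co-lexicographic order becomes the lexicographic order of
lists.

A pattern excludes Wheeler automata: following `μ` or `ν` by `k` turns of the cycle gives two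
sequences of words that interleave monotonically in `k`, while the sets of states reached in a
Wheeler automaton are monotone, so that one set would recur on both sides of another
(`not_isWheelerLanguage_of_alternating`). Conversely, a language is Wheeler if, among the prefixes
that share their last `N` letters, those with equal continuations are convex
(`isWheelerLanguage_of_convex`). If this fails for `N = n ^ 3`, with `n` states, then three prefixes
violate convexity; the pigeonhole principle on triples of states finds a common cycle label `γ` in
their common suffix. Comparing what precedes the cycle in the middle prefix with a long power of `γ`
shows which two of the three prefixes lie on one side of it (`hasPattern_of_cycles`).

The pattern can be found in polynomial time because it is the least fixed point of a fixed set of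
Horn rules over numbers bounded by the length of the input. The rules guess `γ` letter by letter,
backwards, remembering only the side, the states `u` and `v`, the current states on both cycles, and
how far `μ` and `ν` still agree with `γ`. A fixed Horn program has polynomially many facts, so they
can be stored as bits on tapes and saturated (`HornProgram.computableInPolyTime`). The evaluator is
a structured stack program whose compilation into a Turing machine preserves the number of steps
(`Runs.stepsTo`). -/

open Turing

/-! ### Structured stack programs and their compilation to Turing machines -/

/-- The internal memory of the machines built here: the symbol popped last and two flags. -/
structure Mem where
  top : Option Bool
  ok : Bool
  changed : Bool
deriving Fintype

/-- Structured programs over finitely many stacks of bits. -/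
inductive StackProg (K : Type) : Type
  | push (k : K) (f : Mem → Bool)
  | pop (k : K)
  | load (f : Mem → Mem)
  | seq (P Q : StackProg K)
  | ite (b : Mem → Bool) (P Q : StackProg K)
  | popLoop (k : K) (P : StackProg K)
  | loopWhile (b : Mem → Bool) (P : StackProg K)

namespace StackProg

variable {K : Type}

/-- The labels of the machine code of a program. -/
def Lab : StackProg K → Type
  | push _ _ => Unit
  | pop _ => Unit
  | load _ => Unit
  | seq P Q => Lab P ⊕ Lab Q
  | ite _ P Q => Option (Lab P ⊕ Lab Q)
  | popLoop _ P => Option (Lab P)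
  | loopWhile _ P => Option (Lab P)

/-- There are finitely many labels. -/
theorem finite_lab : (P : StackProg K) → Finite (Lab P)
  | push _ _ => inferInstanceAs (Finite Unit)
  | pop _ => inferInstanceAs (Finite Unit)
  | load _ => inferInstanceAs (Finite Unit)
  | seq P Q =>
    haveI := finite_lab P; haveI := finite_lab Q; inferInstanceAs (Finite (Lab P ⊕ Lab Q))
  | ite _ P Q =>
    haveI := finite_lab P; haveI := finite_lab Q; inferInstanceAs (Finite (Option (Lab P ⊕ Lab Q)))
  | popLoop _ P => haveI := finite_lab P; inferInstanceAs (Finite (Option (Lab P)))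
  | loopWhile _ P => haveI := finite_lab P; inferInstanceAs (Finite (Option (Lab P)))

/-- The label at which the machine code of a program starts. -/
def entry : (P : StackProg K) → Lab P
  | push _ _ => ()
  | pop _ => ()
  | load _ => ()
  | seq P _ => Sum.inl (entry P)
  | ite _ _ _ => (none : Option _)
  | popLoop _ _ => (none : Option _)
  | loopWhile _ _ => (none : Option _)

/-- The machine code of a program whose labels are embedded into `L` by `e`, and which goes on to
the label `out` in the end. -/
def code {L : Type} : (P : StackProg K) → (e : Lab P → L) → (out : L) →
    Lab P → TM2.Stmt (fun _ : K => Bool) L Mem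
  | push k f, _, out => fun _ => .push k f (.goto fun _ => out)
  | pop k, _, out => fun _ => .pop k (fun v o => { v with top := o }) (.goto fun _ => out)
  | load f, _, out => fun _ => .load f (.goto fun _ => out)
  | seq P Q, e, out =>
    Sum.elim (code P (fun x => e (Sum.inl x)) (e (Sum.inr (entry Q))))
      (code Q (fun x => e (Sum.inr x)) out)
  | ite b P Q, e, out => fun x => Option.elim x
      (.branch b (.goto fun _ => e (some (Sum.inl (entry P))))
        (.goto fun _ => e (some (Sum.inr (entry Q)))))
      (Sum.elim (code P (fun x => e (some (Sum.inl x))) out)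
        (code Q (fun x => e (some (Sum.inr x))) out))
  | popLoop k P, e, out => fun x => Option.elim x
      (.pop k (fun v o => { v with top := o })
        (.branch (fun v => v.top.isSome) (.goto fun _ => e (some (entry P))) (.goto fun _ => out)))
      (code P (fun x => e (some x)) (e none))
  | loopWhile b P, e, out => fun x => Option.elim x
      (.branch b (.goto fun _ => e (some (entry P))) (.goto fun _ => out))
      (code P (fun x => e (some x)) (e none))

variable [DecidableEq K]

/-- `Runs P v S v' S' t`: the program `P`, started with memory `v` and stacks `S`, ends after `t`
steps with memory `v'` and stacks `S'`. -/
inductive Runs : StackProg K → Mem → (K → List Bool) → Mem → (K → List Bool) → ℕ → Prop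
  | push (k : K) (f : Mem → Bool) (v S) :
      Runs (push k f) v S v (Function.update S k (f v :: S k)) 1
  | pop (k : K) (v S) :
      Runs (pop k) v S { v with top := (S k).head? } (Function.update S k (S k).tail) 1
  | load (f : Mem → Mem) (v S) : Runs (load f) v S (f v) S 1
  | seq {P Q v S v₁ S₁ v₂ S₂ t₁ t₂} (h₁ : Runs P v S v₁ S₁ t₁) (h₂ : Runs Q v₁ S₁ v₂ S₂ t₂) :
      Runs (seq P Q) v S v₂ S₂ (t₁ + t₂)
  | ite_true {b : Mem → Bool} {P Q v S v₁ S₁ t} (hb : b v = true) (h : Runs P v S v₁ S₁ t) :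
      Runs (ite b P Q) v S v₁ S₁ (1 + t)
  | ite_false {b : Mem → Bool} {P Q v S v₁ S₁ t} (hb : b v = false) (h : Runs Q v S v₁ S₁ t) :
      Runs (ite b P Q) v S v₁ S₁ (1 + t)
  | popLoop_nil {k : K} {P v S} (hk : S k = []) :
      Runs (popLoop k P) v S { v with top := none } S 1
  | popLoop_cons {k : K} {P v S a l v₁ S₁ v₂ S₂ t₁ t₂} (hk : S k = a :: l)
      (h₁ : Runs P { v with top := some a } (Function.update S k l) v₁ S₁ t₁)
      (h₂ : Runs (popLoop k P) v₁ S₁ v₂ S₂ t₂) :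
      Runs (popLoop k P) v S v₂ S₂ (1 + t₁ + t₂)
  | loopWhile_false {b : Mem → Bool} {P v S} (hb : b v = false) : Runs (loopWhile b P) v S v S 1
  | loopWhile_true {b : Mem → Bool} {P v S v₁ S₁ v₂ S₂ t₁ t₂} (hb : b v = true)
      (h₁ : Runs P v S v₁ S₁ t₁) (h₂ : Runs (loopWhile b P) v₁ S₁ v₂ S₂ t₂) :
      Runs (loopWhile b P) v S v₂ S₂ (1 + t₁ + t₂)

/-- `t` steps of the machine `M` lead from the first configuration to the second. -/
def StepsTo {L : Type} (M : L → TM2.Stmt (fun _ : K => Bool) L Mem) (t : ℕ)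
    (c c' : TM2.Cfg (fun _ : K => Bool) L Mem) : Prop :=
  (flip bind (TM2.step M))^[t] (some c) = some c'

theorem StepsTo.trans {L : Type} {M : L → TM2.Stmt (fun _ : K => Bool) L Mem} {t₁ t₂ : ℕ}
    {c₁ c₂ c₃ : TM2.Cfg (fun _ : K => Bool) L Mem} (h₁ : StepsTo M t₁ c₁ c₂)
    (h₂ : StepsTo M t₂ c₂ c₃) : StepsTo M (t₁ + t₂) c₁ c₃ := by
  unfold StepsTo at *
  rw [add_comm, Function.iterate_add_apply, h₁, h₂]

theorem stepsTo_one {L : Type} {M : L → TM2.Stmt (fun _ : K => Bool) L Mem} {l : L} {v : Mem}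
    {S : K → List Bool} {q} {c'} (hM : M l = q) (h : TM2.stepAux q v S = c') :
    StepsTo M 1 ⟨some l, v, S⟩ c' := by
  subst hM h; rfl

/-- The machine code of a program does what the program does, in as many steps. -/
theorem Runs.stepsTo {P : StackProg K} {v S v' S' t} (h : Runs P v S v' S' t) {L : Type}
    (M : L → TM2.Stmt (fun _ : K => Bool) L Mem) : ∀ (e : Lab P → L) (out : L),
    (∀ x, M (e x) = code P e out x) →
    StepsTo M t ⟨some (e (entry P)), v, S⟩ ⟨some out, v', S'⟩ := by
  induction h with
  | push k f v S => exact fun e out hM => stepsTo_one (hM ()) (by simp [code])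
  | pop k v S => exact fun e out hM => stepsTo_one (hM ()) (by simp [code])
  | load f v S => exact fun e out hM => stepsTo_one (hM ()) (by simp [code])
  | seq _ _ ih₁ ih₂ =>
    exact fun e out hM => (ih₁ (fun x => e (Sum.inl x)) _ fun x => hM (Sum.inl x)).trans
      (ih₂ (fun x => e (Sum.inr x)) out fun x => hM (Sum.inr x))
  | ite_true hb _ ih =>
    exact fun e out hM => StepsTo.trans (stepsTo_one (hM none) (by simp [code, hb]))
      (ih (fun x => e (some (Sum.inl x))) out fun x => hM (some (Sum.inl x)))
  | ite_false hb _ ih =>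
    exact fun e out hM => StepsTo.trans (stepsTo_one (hM none) (by simp [code, hb]))
      (ih (fun x => e (some (Sum.inr x))) out fun x => hM (some (Sum.inr x)))
  | popLoop_nil hk =>
    exact fun e out hM => stepsTo_one (hM none)
      (by simp [code, hk, Function.update_eq_self_iff])
  | popLoop_cons hk _ _ ih₁ ih₂ =>
    exact fun e out hM => StepsTo.trans (StepsTo.trans
      (stepsTo_one (hM none) (by simp [code, hk]))
      (ih₁ (fun x => e (some x)) (e none) fun x => hM (some x))) (ih₂ e out hM)
  | loopWhile_false hb =>
    exact fun e out hM => stepsTo_one (hM none) (by simp [code, hb])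
  | loopWhile_true hb _ _ ih₁ ih₂ =>
    exact fun e out hM => StepsTo.trans (StepsTo.trans
      (stepsTo_one (hM none) (by simp [code, hb]))
      (ih₁ (fun x => e (some x)) (e none) fun x => hM (some x))) (ih₂ e out hM)

/-- `Within P v S v' S' n`: the program `P` leads from memory `v` and stacks `S` to memory `v'` and
stacks `S'` in at most `n` steps. -/
def Within (P : StackProg K) (v : Mem) (S : K → List Bool) (v' : Mem) (S' : K → List Bool)
    (n : ℕ) : Prop :=
  ∃ t ≤ n, Runs P v S v' S' t

/-- The machine that runs a program, with input on the stack `k₀` and output on the stack `k₁`. -/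
noncomputable def toFinTM2 [Fintype K] (P : StackProg K) (k₀ k₁ : K) : FinTM2 where
  K := K
  k₀ := k₀
  k₁ := k₁
  Γ := fun _ => Bool
  Λ := Option (Lab P)
  main := some (entry P)
  ΛFin := haveI := finite_lab P; Fintype.ofFinite _
  σ := Mem
  initialState := ⟨none, false, false⟩
  m := fun x => Option.elim x .halt (code P some none)

theorem initList_toFinTM2 [Fintype K] (P : StackProg K) (k₀ k₁ : K) (w : List Bool) :
    initList (toFinTM2 P k₀ k₁) w =
      ⟨some (some (entry P)), ⟨none, false, false⟩, Function.update (fun _ => []) k₀ w⟩ := by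
  have h : ∀ k : K, (initList (toFinTM2 P k₀ k₁) w).stk k =
      Function.update (fun _ => []) k₀ w k := by
    intro k
    by_cases hk : k = k₀
    · subst hk
      rw [Function.update_self]
      exact (dif_pos rfl).trans rfl
    · rw [Function.update_of_ne hk]
      exact dif_neg hk
  exact congrArg (fun S => (⟨some (some (entry P)), ⟨none, false, false⟩, S⟩ :
    TM2.Cfg (fun _ : K => Bool) (Option (Lab P)) Mem)) (funext h)

theorem haltList_toFinTM2 [Fintype K] (P : StackProg K) (k₀ k₁ : K) (w : List Bool) :
    haltList (toFinTM2 P k₀ k₁) w =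
      ⟨none, ⟨none, false, false⟩, Function.update (fun _ => []) k₁ w⟩ := by
  have h : ∀ k : K, (haltList (toFinTM2 P k₀ k₁) w).stk k =
      Function.update (fun _ => []) k₁ w k := by
    intro k
    by_cases hk : k = k₁
    · subst hk
      rw [Function.update_self]
      exact (dif_pos rfl).trans rfl
    · rw [Function.update_of_ne hk]
      exact dif_neg hk
  exact congrArg (fun S => (⟨none, ⟨none, false, false⟩, S⟩ :
    TM2.Cfg (fun _ : K => Bool) (Option (Lab P)) Mem)) (funext h)

/-- A program that computes the bit `g w` from the word `w` in polynomially many steps gives a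
polynomial time machine. -/
theorem computableInPolyTime_of_within [Fintype K] (P : StackProg K) (k₀ k₁ : K)
    (g : List Bool → Bool) (p : Polynomial ℕ)
    (h : ∀ w : List Bool, Within P ⟨none, false, false⟩
      (Function.update (fun _ => []) k₀ w) ⟨none, false, false⟩
      (Function.update (fun _ => []) k₁ [g w]) (p.eval w.length))
    {α : Type} (enc : α → List Bool) :
    Nonempty (TM2ComputableInPolyTime enc Computability.encodeBool fun x => g (enc x)) := by
  refine ⟨{ tm := toFinTM2 P k₀ k₁
            inputAlphabet := Equiv.refl Bool
            outputAlphabet := Equiv.refl Bool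
            -- The extra step executes the `halt` statement at the label `none`.
            time := p + 1
            outputsFun := fun a => ?_ }⟩
  have ht := Classical.choose_spec (h (enc a))
  refine ⟨⟨Classical.choose (h (enc a)) + 1, ?_⟩, ?_⟩
  · have e : ∀ l : List Bool, List.map (Equiv.refl Bool).invFun l = l := fun l => List.map_id l
    have h₁ : initList (toFinTM2 P k₀ k₁) (List.map (Equiv.refl Bool).invFun (enc a)) = _ :=
      (congrArg _ (e _)).trans (initList_toFinTM2 P k₀ k₁ (enc a))
    have h₂ : haltList (toFinTM2 P k₀ k₁) (List.map (Equiv.refl Bool).invFun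
        (Computability.encodeBool (g (enc a)))) = _ :=
      (congrArg _ (e _)).trans (haltList_toFinTM2 P k₀ k₁ [g (enc a)])
    rw [h₁, Option.map_some, h₂]
    exact (ht.2.stepsTo (toFinTM2 P k₀ k₁).m some none fun x => rfl).trans (stepsTo_one rfl rfl)
  · simpa using ht.1

end StackProg

/-! ### Upper bounds for the running time of structured programs -/

namespace StackProg

section Within

variable {K : Type} [DecidableEq K]

theorem Within.mono {P : StackProg K} {v S v' S' n m} (h : Within P v S v' S' n) (hnm : n ≤ m) :
    Within P v S v' S' m :=
  let ⟨t, ht, hr⟩ := h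
  ⟨t, ht.trans hnm, hr⟩

theorem Within.cast {P : StackProg K} {v S v₁ S₁ v₂ S₂ n m} (h : Within P v S v₁ S₁ n)
    (hv : v₁ = v₂) (hS : S₁ = S₂) (hnm : n ≤ m) : Within P v S v₂ S₂ m :=
  hv ▸ hS ▸ h.mono hnm

theorem Within.seq {P Q : StackProg K} {v S v₁ S₁ v₂ S₂ n m} (h₁ : Within P v S v₁ S₁ n)
    (h₂ : Within Q v₁ S₁ v₂ S₂ m) : Within (seq P Q) v S v₂ S₂ (n + m) :=
  let ⟨_, ht, hr⟩ := h₁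
  let ⟨_, ht', hr'⟩ := h₂
  ⟨_, add_le_add ht ht', .seq hr hr'⟩

theorem within_load (f : Mem → Mem) (v : Mem) (S : K → List Bool) :
    Within (load f) v S (f v) S 1 :=
  ⟨1, le_rfl, .load f v S⟩

theorem within_push (k : K) (f : Mem → Bool) (v : Mem) (S : K → List Bool) :
    Within (push k f) v S v (Function.update S k (f v :: S k)) 1 :=
  ⟨1, le_rfl, .push k f v S⟩

theorem within_pop (k : K) (v : Mem) (S : K → List Bool) :
    Within (pop k) v S { v with top := (S k).head? } (Function.update S k (S k).tail) 1 :=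
  ⟨1, le_rfl, .pop k v S⟩

theorem Within.ite_true {b : Mem → Bool} {P Q : StackProg K} {v S v₁ S₁ n} (hb : b v = true)
    (h : Within P v S v₁ S₁ n) : Within (ite b P Q) v S v₁ S₁ (1 + n) :=
  let ⟨_, ht, hr⟩ := h
  ⟨_, Nat.add_le_add_left ht 1, .ite_true hb hr⟩

theorem Within.ite_false {b : Mem → Bool} {P Q : StackProg K} {v S v₁ S₁ n} (hb : b v = false)
    (h : Within Q v S v₁ S₁ n) : Within (ite b P Q) v S v₁ S₁ (1 + n) :=
  let ⟨_, ht, hr⟩ := h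
  ⟨_, Nat.add_le_add_left ht 1, .ite_false hb hr⟩

theorem within_popLoop_nil {k : K} {P : StackProg K} {v S} (hk : S k = []) :
    Within (popLoop k P) v S { v with top := none } S 1 :=
  ⟨1, le_rfl, .popLoop_nil hk⟩

theorem Within.popLoop_cons {k : K} {P : StackProg K} {v S a l v₁ S₁ v₂ S₂ n m} (hk : S k = a :: l)
    (h₁ : Within P { v with top := some a } (Function.update S k l) v₁ S₁ n)
    (h₂ : Within (popLoop k P) v₁ S₁ v₂ S₂ m) : Within (popLoop k P) v S v₂ S₂ (1 + n + m) :=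
  let ⟨_, ht, hr⟩ := h₁
  let ⟨_, ht', hr'⟩ := h₂
  ⟨_, by gcongr, .popLoop_cons hk hr hr'⟩

theorem within_loopWhile_false {b : Mem → Bool} {P : StackProg K} {v S} (hb : b v = false) :
    Within (loopWhile b P) v S v S 1 :=
  ⟨1, le_rfl, .loopWhile_false hb⟩

theorem Within.loopWhile_true {b : Mem → Bool} {P : StackProg K} {v S v₁ S₁ v₂ S₂ n m}
    (hb : b v = true) (h₁ : Within P v S v₁ S₁ n) (h₂ : Within (loopWhile b P) v₁ S₁ v₂ S₂ m) :
    Within (loopWhile b P) v S v₂ S₂ (1 + n + m) :=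
  let ⟨_, ht, hr⟩ := h₁
  let ⟨_, ht', hr'⟩ := h₂
  ⟨_, by gcongr, .loopWhile_true hb hr hr'⟩

end Within

/-! ### Registers made of two stacks, and counted loops -/

section Registers

variable {R : Type} [DecidableEq R]

/-- A register consists of a main stack and an auxiliary stack; this replaces the contents of both
stacks of the register `r`. -/
def setReg (S : R × Bool → List Bool) (r : R) (x : List Bool × List Bool) :
    R × Bool → List Bool :=
  fun k => if k.1 = r then (if k.2 then x.2 else x.1) else S k

/-- The contents of the two stacks of a register. -/
def getReg (S : R × Bool → List Bool) (r : R) : List Bool × List Bool := (S (r, false), S (r, true))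

/-- Apply a function to the contents of a register. -/
def act (r : R) (f : List Bool × List Bool → List Bool × List Bool) (S : R × Bool → List Bool) :
    R × Bool → List Bool :=
  setReg S r (f (getReg S r))

@[simp] theorem setReg_main (S : R × Bool → List Bool) (r x) : setReg S r x (r, false) = x.1 := by
  simp [setReg]

@[simp] theorem setReg_aux (S : R × Bool → List Bool) (r x) : setReg S r x (r, true) = x.2 := by
  simp [setReg]

theorem setReg_of_ne (S : R × Bool → List Bool) {r r' : R} (h : r' ≠ r) (x b) :
    setReg S r x (r', b) = S (r', b) := by
  simp [setReg, h]

@[simp] theorem getReg_setReg (S : R × Bool → List Bool) (r x) : getReg (setReg S r x) r = x := by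
  simp [getReg]

theorem getReg_setReg_of_ne (S : R × Bool → List Bool) {r r' : R} (h : r' ≠ r) (x) :
    getReg (setReg S r x) r' = getReg S r' := by
  simp [getReg, setReg_of_ne _ h]

@[simp] theorem setReg_setReg (S : R × Bool → List Bool) (r x y) :
    setReg (setReg S r x) r y = setReg S r y := by
  funext k; simp only [setReg]; split_ifs <;> rfl

theorem setReg_comm (S : R × Bool → List Bool) {r r' : R} (h : r' ≠ r) (x y) :
    setReg (setReg S r x) r' y = setReg (setReg S r' y) r x := by
  funext k; simp only [setReg]; split_ifs <;> simp_all

@[simp] theorem setReg_getReg (S : R × Bool → List Bool) (r) : setReg S r (getReg S r) = S := by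
  funext ⟨k, b⟩; simp only [setReg, getReg]; split_ifs <;> simp_all

theorem update_main (S : R × Bool → List Bool) (r l) :
    Function.update S (r, false) l = setReg S r (l, S (r, true)) := by
  funext ⟨k, b⟩
  by_cases hk : k = r <;> cases b <;> simp [Function.update, setReg, hk]

theorem update_aux (S : R × Bool → List Bool) (r l) :
    Function.update S (r, true) l = setReg S r (S (r, false), l) := by
  funext ⟨k, b⟩
  by_cases hk : k = r <;> cases b <;> simp [Function.update, setReg, hk]

theorem act_of_ne (S : R × Bool → List Bool) {r r' : R} (h : r' ≠ r) (f b) :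
    act r f S (r', b) = S (r', b) :=
  setReg_of_ne S h _ b

theorem act_act (S : R × Bool → List Bool) (r : R) (f g) : act r f (act r g S) = act r (f ∘ g) S := by
  simp [act]

@[simp] theorem act_id (S : R × Bool → List Bool) (r : R) : act r id S = S := by simp [act]

/-- Move the contents of the auxiliary stack of a register back to the main stack. -/
def rewind (r : R) : StackProg (R × Bool) :=
  popLoop (r, true) (push (r, false) fun v => v.top.getD false)

/-- Each symbol costs two steps, a pop and a push; the last step finds the auxiliary stack empty.
Since that stack is filled in reverse, rewinding restores the original order. -/
theorem within_rewind (r : R) (v : Mem) (S : R × Bool → List Bool) :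
    Within (rewind r) v S { v with top := none }
      (act r (fun x => (x.2.reverse ++ x.1, [])) S) (2 * (S (r, true)).length + 1) := by
  generalize hl : S (r, true) = l
  induction l generalizing v S with
  | nil =>
    convert! within_popLoop_nil hl
    simp only [act, getReg, hl]
    conv_rhs => rw [← setReg_getReg S r]
    simp [getReg, hl]
  | cons a l ih =>
    refine Within.mono (Within.popLoop_cons hl (within_push _ _ _ _) ?_)
      (m := 2 * (a :: l).length + 1) (n := 1 + 1 + (2 * l.length + 1)) (by simp; omega)
    convert! ih { v with top := some a } (setReg S r (a :: S (r, false), l)) (by simp) using 1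
    · simp [update_main, update_aux]
    · simp [act, getReg, hl]

/-- Run `Q` as many times as the height of the register `c`. -/
def loop (c : R) (Q : StackProg (R × Bool)) : StackProg (R × Bool) :=
  seq (popLoop (c, false) (seq (push (c, true) fun v => v.top.getD false)
    (seq (load fun v => { v with top := none }) Q))) (rewind c)

/-- The hypothesis on `Q` covers all stacks that agree with `S₀` outside `c` and `r`: during the
loop the counter `c` is partly on its auxiliary stack, and `r` has been changed by earlier rounds.
All other registers, such as the counters of inner loops, are the same in every round. -/
theorem within_loop_aux (c r : R) (hcr : c ≠ r) (Q : StackProg (R × Bool)) (v : Mem)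
    (hv : v.top = none) (f) (T : ℕ) (S₀ : R × Bool → List Bool)
    (hQ : ∀ S : R × Bool → List Bool, (∀ k, k ≠ c → k ≠ r → ∀ b, S (k, b) = S₀ (k, b)) →
      Within Q v S v (act r f S) T)
    (l : List Bool) (S : R × Bool → List Bool)
    (hS : ∀ k, k ≠ c → k ≠ r → ∀ b, S (k, b) = S₀ (k, b)) (hl : S (c, false) = l) :
    Within (popLoop (c, false) (seq (push (c, true) fun v => v.top.getD false)
      (seq (load fun v => { v with top := none }) Q))) v S v
      (act r f^[l.length] (act c (fun x => ([], x.1.reverse ++ x.2)) S))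
      (l.length * (T + 3) + 1) := by
  induction l generalizing S with
  | nil =>
    convert! within_popLoop_nil hl using 1
    · rw [← hv]
    · simp only [List.length_nil, Function.iterate_zero, act_id]
      conv_rhs => rw [← setReg_getReg S c]
      simp [act, getReg, hl]
    · simp
  | cons a l ih =>
    have hv' : { v with top := none } = v := by rw [← hv]
    have hS' : ∀ k, k ≠ c → k ≠ r → ∀ b,
        setReg S c (l, a :: S (c, true)) (k, b) = S₀ (k, b) := fun k hk hk' b => by
      rw [setReg_of_ne _ hk, hS k hk hk']
    set S₁ := setReg S c (l, a :: S (c, true)) with hS₁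
    have h₁ : Within (seq (push (c, true) fun v => v.top.getD false)
        (seq (load fun v => { v with top := none }) Q)) { v with top := some a }
        (Function.update S (c, false) l) v (act r f S₁) (1 + (1 + T)) := by
      refine Within.seq (within_push _ _ _ _) (Within.seq (within_load _ _ _) ?_)
      convert! hQ S₁ hS' using 1
      simp [update_main, update_aux, hS₁]
    refine (Within.popLoop_cons hl h₁ (ih (act r f S₁) ?_ ?_)).cast rfl ?_ ?_
    · exact fun k hk hk' b => by rw [act_of_ne _ hk', hS' k hk hk']
    · rw [act_of_ne _ hcr, hS₁, setReg_main]
    · rw [List.length_cons, Function.iterate_succ, ← act_act]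
      congr 1
      simp only [act, hS₁, getReg_setReg_of_ne _ hcr, getReg_setReg_of_ne _ hcr.symm,
        setReg_comm _ hcr, setReg_setReg, getReg_setReg]
      simp [getReg, hl]
    · rw [List.length_cons]; ring_nf; omega

theorem within_loop (c r : R) (hcr : c ≠ r) (Q : StackProg (R × Bool)) (v : Mem)
    (hv : v.top = none) (f) (T : ℕ) (S : R × Bool → List Bool) (hc : S (c, true) = [])
    (hQ : ∀ S' : R × Bool → List Bool, (∀ k, k ≠ c → k ≠ r → ∀ b, S' (k, b) = S (k, b)) →
      Within Q v S' v (act r f S') T) :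
    Within (loop c Q) v S v (act r f^[(S (c, false)).length] S)
      ((S (c, false)).length * (T + 5) + 2) := by
  refine (Within.seq (within_loop_aux c r hcr Q v hv f T S hQ (S (c, false)) S
    (fun _ _ _ _ => rfl) rfl) (within_rewind c v _)).cast ?_ ?_ ?_
  · rw [← hv]
  · simp only [act, getReg_setReg_of_ne _ hcr, getReg_setReg_of_ne _ hcr.symm,
      setReg_comm _ hcr, setReg_setReg, getReg_setReg]
    conv_rhs => rw [← setReg_getReg S c]
    rw [getReg_setReg_of_ne _ hcr.symm]
    simp [getReg, hc]
  · rw [act_of_ne _ hcr]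
    simp [act, getReg, hc]
    ring_nf; omega

end Registers

end StackProg

/-- A term of a rule: a variable or zero, plus a constant. -/
structure RuleTerm (V : Type) where
  var : Option V
  const : ℕ

/-- The value of a term. -/
def RuleTerm.val {V : Type} (ν : V → ℕ) (τ : RuleTerm V) : ℕ := τ.var.elim 0 ν + τ.const

/-- A Horn rule with variables `V` and relation symbols `T`: if the letters of the input word at the
given positions are as listed, and the listed facts hold, then so does the fact `head`. -/
structure HornRule (V T : Type) where
  inputs : List (RuleTerm V × Bool)
  body : List (T × List (RuleTerm V))
  head : T × List (RuleTerm V)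

/-- A Horn program: rules over relation symbols with arities, and a bound on the constants. -/
structure HornProgram (V T : Type) where
  rules : List (HornRule V T)
  arity : T → ℕ
  maxConst : ℕ
  body_arity : ∀ ρ ∈ rules, ∀ l ∈ ρ.body, l.2.length = arity l.1
  body_const : ∀ ρ ∈ rules, ∀ l ∈ ρ.body, ∀ τ ∈ l.2, τ.const ≤ maxConst
  head_arity : ∀ ρ ∈ rules, ρ.head.2.length = arity ρ.head.1
  head_const : ∀ ρ ∈ rules, ∀ τ ∈ ρ.head.2, τ.const ≤ maxConst

/-- The facts that a Horn program derives from the input word `w`, where the variables range over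
the numbers up to the length of `w`. -/
inductive HornProgram.Derives {V T : Type} (D : HornProgram V T) (w : List Bool) :
    T → List ℕ → Prop
  | rule (ρ : HornRule V T) (hρ : ρ ∈ D.rules) (ν : V → ℕ) (hν : ∀ v, ν v ≤ w.length)
      (hi : ∀ l ∈ ρ.inputs, w[l.1.val ν]? = some l.2)
      (hb : ∀ l ∈ ρ.body, D.Derives w l.1 (l.2.map (RuleTerm.val ν))) :
      D.Derives w ρ.head.1 (ρ.head.2.map (RuleTerm.val ν))

/-! ### Addressing the cells of a tape by tuples of numbers -/

namespace StackProg

/-- The registers of the machine that evaluates a Horn program: for each variable its value and the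
number of values still to come, copies of the base of the numbering of tuples, and a tape for the
input and for each relation symbol. -/
inductive Reg (V T : Type) (J : ℕ)
  | val (v : V)
  | lim (v : V)
  | base (j : Fin J)
  | tape (t : Option T)
  | out
deriving DecidableEq, Fintype

section Seek

variable {R : Type} [DecidableEq R]

/-- The effect of moving one symbol from the main stack to the auxiliary stack. -/
def moveOne (x : List Bool × List Bool) : List Bool × List Bool :=
  (x.1.tail, x.1.head?.toList ++ x.2)

/-- The two stacks form a tape with the head between them. At the end of the tape a move has no
effect, in accordance with `take` and `drop`. -/
theorem moveOne_iterate (n : ℕ) (x : List Bool × List Bool) :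
    moveOne^[n] x = (x.1.drop n, (x.1.take n).reverse ++ x.2) := by
  induction n generalizing x with
  | zero => simp
  | succ n ih =>
    rw [Function.iterate_succ_apply, ih]
    rcases x with ⟨_ | ⟨a, l⟩, m⟩ <;> simp [moveOne]

/-- The program that does nothing. -/
def skip : StackProg R := load id

/-- Move one symbol from the main stack of a register to the auxiliary stack. -/
def move (r : R) : StackProg (R × Bool) :=
  seq (pop (r, false)) (seq (ite (fun v => v.top.isSome)
    (push (r, true) fun v => v.top.getD false) skip) (load fun v => { v with top := none }))

theorem within_skip (v : Mem) (S : R → List Bool) : Within skip v S v S 1 := within_load id v S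

theorem within_move (r : R) (v : Mem) (hv : v.top = none) (S : R × Bool → List Bool) :
    Within (move r) v S v (act r moveOne S) 4 := by
  have hv' : { v with top := none } = v := by rw [← hv]
  refine Within.seq (n := 1) (m := 3) (within_pop _ _ _) ?_
  refine Within.seq (n := 2) (m := 1) (v₁ := { v with top := (S (r, false)).head? })
    (S₁ := act r moveOne S) ?_ ((within_load _ _ _).cast hv' rfl le_rfl)
  rcases h : S (r, false) with _ | ⟨a, l⟩
  · refine Within.ite_false rfl ((within_skip _ _).cast rfl ?_ le_rfl)
    rw [update_main]; simp [act, getReg, moveOne, h]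
  · refine Within.ite_true rfl ((within_push _ _ _ _).cast rfl ?_ le_rfl)
    rw [update_main, update_aux]; simp [act, getReg, moveOne, h]

/-- Run a program a fixed number of times. -/
def iter (P : StackProg R) : ℕ → StackProg R
  | 0 => skip
  | n + 1 => seq P (iter P n)

theorem within_iter_move (r : R) (v : Mem) (hv : v.top = none) (c : ℕ) (S : R × Bool → List Bool) :
    Within (iter (move r) c) v S v (act r moveOne^[c] S) (4 * c + 1) := by
  induction c generalizing S with
  | zero => exact (within_skip _ _).cast rfl (by simp) le_rfl
  | succ c ih =>
    refine (Within.seq (within_move r v hv S) (ih _)).cast rfl ?_ (by omega)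
    rw [act_act, Function.iterate_succ]

end Seek

section Tape

variable {V T : Type} {J : ℕ} [DecidableEq V] [DecidableEq T]

/-- Move along the register `r` by the value of a term. -/
def moveTerm (r : Reg V T J) (τ : RuleTerm V) : StackProg (Reg V T J × Bool) :=
  seq (τ.var.elim skip fun v => loop (.val v) (move r)) (iter (move r) τ.const)

/-- Move along the register `r` to the position that encodes a tuple of terms. -/
def seek (r : Reg V T J) : List (RuleTerm V) → List (Fin J) → StackProg (Reg V T J × Bool)
  | τ :: ts, b :: bs => seq (moveTerm r τ) (loop (.base b) (seek r ts bs))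
  | _, _ => skip

/-- The registers for the variables contain the values `ν`, and those for the base contain `C`. -/
def CountersOK (C : ℕ) (ν : V → ℕ) (bs : List (Fin J)) (S : Reg V T J × Bool → List Bool) : Prop :=
  (∀ v, S (.val v, false) = List.replicate (ν v) true ∧ S (.val v, true) = []) ∧
  ∀ b ∈ bs, S (.base b, false) = List.replicate C true ∧ S (.base b, true) = []

theorem within_moveTerm (t : Option T) (τ : RuleTerm V) : ∃ p : Polynomial ℕ,
    ∀ (n C : ℕ) (ν : V → ℕ) (bs : List (Fin J)) (S : Reg V T J × Bool → List Bool) (v : Mem),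
    C ≤ n → (∀ v, ν v ≤ n) → v.top = none → CountersOK C ν bs S →
    Within (moveTerm (.tape t) τ) v S v (act (.tape t) moveOne^[τ.val ν] S) (p.eval n) := by
  refine ⟨Polynomial.X * 9 + 2 + (4 * Polynomial.C τ.const + 1), ?_⟩
  intro n C ν bs S v hC hν hv hS
  have h₁ : Within (τ.var.elim skip fun v => loop (.val v) (move (.tape t))) v S v
      (act (.tape t) moveOne^[τ.var.elim 0 ν] S) (n * 9 + 2) := by
    rcases τ.var with _ | x
    · exact (within_skip _ _).cast rfl (by simp) (by omega)
    · refine (within_loop (.val x) (.tape t) (by simp) (move (.tape t)) v hv moveOne 4 S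
        (hS.1 x).2 fun S' _ => within_move _ v hv S').cast rfl ?_ ?_
      · simp [(hS.1 x).1]
      · simp [(hS.1 x).1, hν x]
  refine (Within.seq h₁ (within_iter_move _ v hv τ.const _)).cast rfl ?_ ?_
  · rw [act_act, ← Function.iterate_add, add_comm]; rfl
  · simp

/-- Horner's scheme: the head moves by the first digit and then carries out the search for the
remaining digits `C` times. A running loop has part of its counter on the auxiliary stack, so each
level of nesting needs a base register of its own; this is why `bs` has no duplicates. -/
theorem within_seek (t : Option T) (ts : List (RuleTerm V)) (bs : List (Fin J))
    (hbs : bs.Nodup) (hl : ts.length ≤ bs.length) : ∃ p : Polynomial ℕ,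
    ∀ (n C : ℕ) (ν : V → ℕ) (S : Reg V T J × Bool → List Bool) (v : Mem),
    C ≤ n → (∀ v, ν v ≤ n) → v.top = none → CountersOK C ν bs S →
    Within (seek (.tape t) ts bs) v S v
      (act (.tape t) moveOne^[Nat.ofDigits C (ts.map (RuleTerm.val ν))] S) (p.eval n) := by
  induction ts generalizing bs with
  | nil =>
    refine ⟨1, fun n C ν S v _ _ _ _ => ?_⟩
    simpa [seek, Nat.ofDigits] using within_skip v S
  | cons τ ts ih =>
    obtain _ | ⟨b, bs⟩ := bs
    · simp at hl
    obtain ⟨p, hp⟩ := within_moveTerm (J := J) t τ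
    obtain ⟨q, hq⟩ := ih bs (List.nodup_cons.1 hbs).2 (by simpa using hl)
    refine ⟨p + (Polynomial.X * (q + 5) + 2), fun n C ν S v hC hν hv hS => ?_⟩
    have hb := hS.2 b (by simp)
    set S₁ := act (.tape t) moveOne^[τ.val ν] S with hS₁
    have hS₁' : ∀ r, r ≠ .tape t → ∀ c, S₁ (r, c) = S (r, c) := fun r hr c => act_of_ne _ hr _ _
    have hS₁b : ∀ c, S₁ (.base b, c) = S (.base b, c) := hS₁' _ (by simp)
    refine (Within.seq (hp n C ν _ S v hC hν hv hS) (within_loop (.base b) (.tape t) (by simp) _ v hv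
      _ (q.eval n) S₁ (by rw [hS₁b, hb.2]) fun S' hS' => hq n C ν S' v hC hν hv ?_)).cast rfl ?_ ?_
    · constructor
      · intro x
        rw [hS' _ (by simp) (by simp), hS' _ (by simp) (by simp), hS₁' _ (by simp),
          hS₁' _ (by simp)]
        exact hS.1 x
      · intro b' hb'
        have hne : b' ≠ b := fun h => (List.nodup_cons.1 hbs).1 (h ▸ hb')
        rw [hS' _ (by simpa using hne) (by simp), hS' _ (by simpa using hne) (by simp),
          hS₁' _ (by simp), hS₁' _ (by simp)]
        exact hS.2 b' (by simp [hb'])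
    · rw [hS₁b, hb.1, List.length_replicate, hS₁, act_act, ← Function.iterate_mul,
        ← Function.iterate_add, List.map_cons, Nat.ofDigits_cons]
      congr 2
      ring
    · rw [hS₁b, hb.1, List.length_replicate]
      simp only [Polynomial.eval_add, Polynomial.eval_mul, Polynomial.eval_X,
        Polynomial.eval_ofNat]
      gcongr

/-- Clear the flag `ok` unless the tape `t` has the symbol `b` at the given position. -/
def testTape (bs : List (Fin J)) (t : Option T) (ts : List (RuleTerm V)) (b : Bool) :
    StackProg (Reg V T J × Bool) :=
  seq (seek (.tape t) ts bs) (seq (pop (.tape t, false)) (seq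
    (load fun v => { v with ok := v.ok && (v.top == some b) }) (seq
      (ite (fun v => v.top.isSome) (push (.tape t, true) fun v => v.top.getD false) skip)
      (rewind (.tape t)))))

/-- The cell is popped, compared and passed on to the auxiliary stack, so that rewinding restores
the tape. Beyond the end of the tape the pop yields `none` and the test fails, like `getElem?`. -/
theorem within_testTape (bs : List (Fin J)) (hbs : bs.Nodup) (t : Option T)
    (ts : List (RuleTerm V)) (b : Bool) (hl : ts.length ≤ bs.length) : ∃ p : Polynomial ℕ,
    ∀ (n C : ℕ) (ν : V → ℕ) (S : Reg V T J × Bool → List Bool) (v : Mem),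
    C ≤ n → (∀ v, ν v ≤ n) → v.top = none → CountersOK C ν bs S →
    (S (.tape t, false)).length ≤ n → S (.tape t, true) = [] →
    Within (testTape bs t ts b) v S { v with
      ok := v.ok && ((S (.tape t, false))[Nat.ofDigits C (ts.map (RuleTerm.val ν))]? == some b) } S
      (p.eval n) := by
  obtain ⟨p, hp⟩ := within_seek t ts bs hbs hl
  refine ⟨p + (4 + (2 * Polynomial.X + 1)), fun n C ν S v hC hν hv hS hn ha => ?_⟩
  set i := Nat.ofDigits C (ts.map (RuleTerm.val ν)) with hi
  set S₁ := act (.tape t) moveOne^[i] S with hS₁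
  have h₁ : S₁ (.tape t, false) = (S (.tape t, false)).drop i := by
    simp [hS₁, act, getReg, moveOne_iterate]
  have h₂ : (S₁ (.tape t, false)).head? = (S (.tape t, false))[i]? := by
    rw [h₁, List.head?_drop]
  set v₁ : Mem := ⟨(S₁ (.tape t, false)).head?, v.ok && ((S₁ (.tape t, false)).head? == some b),
    v.changed⟩ with hv₁
  have h₃ : Within (ite (fun v => v.top.isSome) (push (.tape t, true) fun v => v.top.getD false)
      skip) v₁ (Function.update S₁ (.tape t, false) (S₁ (.tape t, false)).tail) v₁
      (act (.tape t) moveOne^[i + 1] S) 2 := by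
    have e : act (.tape t) moveOne^[i + 1] S = act (.tape t) moveOne S₁ := by
      rw [hS₁, act_act, Function.iterate_succ']
    rw [e, update_main]
    rcases h : (S₁ (.tape t, false)).head? with _ | a
    · refine Within.ite_false (by simp [hv₁, h]) ((within_skip _ _).cast rfl ?_ le_rfl)
      simp [act, getReg, moveOne, h]
    · refine Within.ite_true (by simp [hv₁, h]) ((within_push _ _ _ _).cast rfl ?_ le_rfl)
      rw [update_aux]; simp [act, getReg, moveOne, hv₁, h]
  refine (Within.seq (hp n C ν S v hC hν hv hS) (Within.seq (within_pop _ _ _)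
    (Within.seq (within_load _ _ _) (Within.seq h₃ (within_rewind _ _ _))))).cast ?_ ?_ ?_
  · simp [hv₁, h₂, hv]
  · rw [act_act]
    conv_rhs => rw [← setReg_getReg S (.tape t)]
    simp [act, getReg, moveOne_iterate, ha, -Function.iterate_succ]
  · simp only [act, getReg, moveOne_iterate, ha, setReg_aux, List.append_nil, List.length_reverse,
      List.length_take, Polynomial.eval_add, Polynomial.eval_mul, Polynomial.eval_X,
      Polynomial.eval_ofNat, Polynomial.eval_one]
    omega

/-- Write `true` at the given position of the tape `t`, and set the flag `changed` if the position
contained `false`. -/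
def setTape (bs : List (Fin J)) (t : Option T) (ts : List (RuleTerm V)) :
    StackProg (Reg V T J × Bool) :=
  seq (seek (.tape t) ts bs) (seq (pop (.tape t, false)) (seq
    (load fun v => { v with changed := v.changed || (v.top == some false) }) (seq
      (ite (fun v => v.top.isSome) (push (.tape t, false) fun _ => true) skip)
      (rewind (.tape t)))))

/-- Here `true` replaces the popped symbol. Beyond the end of the tape nothing is pushed, which
agrees with `List.set`. -/
theorem within_setTape (bs : List (Fin J)) (hbs : bs.Nodup) (t : Option T)
    (ts : List (RuleTerm V)) (hl : ts.length ≤ bs.length) : ∃ p : Polynomial ℕ,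
    ∀ (n C : ℕ) (ν : V → ℕ) (S : Reg V T J × Bool → List Bool) (v : Mem),
    C ≤ n → (∀ v, ν v ≤ n) → v.top = none → CountersOK C ν bs S →
    (S (.tape t, false)).length ≤ n → S (.tape t, true) = [] →
    Within (setTape bs t ts) v S { v with
      changed := v.changed ||
        ((S (.tape t, false))[Nat.ofDigits C (ts.map (RuleTerm.val ν))]? == some false) }
      (setReg S (.tape t)
        ((S (.tape t, false)).set (Nat.ofDigits C (ts.map (RuleTerm.val ν))) true, []))
      (p.eval n) := by
  obtain ⟨p, hp⟩ := within_seek t ts bs hbs hl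
  refine ⟨p + (4 + (2 * Polynomial.X + 1)), fun n C ν S v hC hν hv hS hn ha => ?_⟩
  set i := Nat.ofDigits C (ts.map (RuleTerm.val ν)) with hi
  set l := S (.tape t, false) with hl
  set S₁ := act (.tape t) moveOne^[i] S with hS₁
  have hS₁' : S₁ = setReg S (.tape t) (l.drop i, (l.take i).reverse) := by
    simp [hS₁, act, getReg, moveOne_iterate, ha, hl]
  have h₁ : S₁ (.tape t, false) = l.drop i := by simp [hS₁']
  have h₂ : (S₁ (.tape t, false)).head? = l[i]? := by rw [h₁, List.head?_drop]
  set v₁ : Mem := ⟨(S₁ (.tape t, false)).head?, v.ok,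
    v.changed || ((S₁ (.tape t, false)).head? == some false)⟩ with hv₁
  have h₃ : Within (ite (fun v => v.top.isSome) (push (.tape t, false) fun _ => true)
      skip) v₁ (Function.update S₁ (.tape t, false) (S₁ (.tape t, false)).tail) v₁
      (setReg S (.tape t) ((l.set i true).drop i, (l.take i).reverse)) 2 := by
    rcases h : (S₁ (.tape t, false)).head? with _ | a
    · refine Within.ite_false (by simp [hv₁, h]) ((within_skip _ _).cast rfl ?_ le_rfl)
      have : l.length ≤ i := by rwa [h₂, List.getElem?_eq_none_iff] at h
      rw [update_main, h₁, hS₁']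
      simp [List.drop_eq_nil_of_le, this]
    · refine Within.ite_true (by simp [hv₁, h]) ((within_push _ _ _ _).cast rfl ?_ le_rfl)
      have : i < l.length := by
        rw [h₂] at h; exact (List.getElem?_eq_some_iff.1 h).1
      rw [update_main, update_main, h₁, hS₁']
      simp only [setReg_setReg, setReg_main, setReg_aux]
      congr 2
      rw [List.drop_set, if_neg (lt_irrefl i), Nat.sub_self, List.drop_eq_getElem_cons this]
      rfl
  refine (Within.seq (hp n C ν S v hC hν hv hS) (Within.seq (within_pop _ _ _)
    (Within.seq (within_load _ _ _) (Within.seq h₃ (within_rewind _ _ _))))).cast ?_ ?_ ?_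
  · simp [hv₁, h₂, hv]
  · simp only [act, getReg_setReg, setReg_setReg, List.reverse_reverse]
    congr 2
    conv_rhs => rw [← List.take_append_drop i (l.set i true)]
    simp [List.take_set, List.set_eq_of_length_le]
  · simp only [setReg_aux, List.length_reverse,
      List.length_take, Polynomial.eval_add, Polynomial.eval_mul, Polynomial.eval_X,
      Polynomial.eval_ofNat, Polynomial.eval_one]
    omega

end Tape

end StackProg

/-! ### Loops over the values of the variables -/

namespace StackProg

section Sweep

variable {V T : Type} {J : ℕ}

/-- The memory between the parts of the program. -/
def mem (ch : Bool) : Mem := ⟨none, false, ch⟩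

/-- The stacks between the parts of the program. -/
def layout (C : ℕ) (ν lim : V → ℕ) (g : Option T → List Bool) : Reg V T J × Bool → List Bool
  | (.val v, false) => List.replicate (ν v) true
  | (.lim v, false) => List.replicate (lim v) true
  | (.base _, false) => List.replicate C true
  | (.tape t, false) => g t
  | _ => []

theorem countersOK_layout (C : ℕ) (ν lim : V → ℕ) (g : Option T → List Bool) (bs : List (Fin J)) :
    CountersOK C ν bs (layout C ν lim g) :=
  ⟨fun _ => ⟨rfl, rfl⟩, fun _ _ => ⟨rfl, rfl⟩⟩

variable [DecidableEq V] [DecidableEq T]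

theorem update_layout_val (C : ℕ) (ν lim : V → ℕ) (g : Option T → List Bool) (v : V) (k : ℕ) :
    Function.update (layout (J := J) C ν lim g) (.val v, false) (List.replicate k true) =
      layout C (Function.update ν v k) lim g := by
  funext ⟨r, b⟩
  by_cases h : (r, b) = (Reg.val v, false)
  · cases h; simp [layout]
  · rw [Function.update_of_ne h]
    cases b
    · cases r with
      | val x =>
        have : x ≠ v := by rintro rfl; exact h rfl
        simp [layout, this]
      | _ => rfl
    · cases r <;> rfl

theorem update_layout_lim (C : ℕ) (ν lim : V → ℕ) (g : Option T → List Bool) (v : V) (k : ℕ) :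
    Function.update (layout (J := J) C ν lim g) (.lim v, false) (List.replicate k true) =
      layout C ν (Function.update lim v k) g := by
  funext ⟨r, b⟩
  by_cases h : (r, b) = (Reg.lim v, false)
  · cases h; simp [layout]
  · rw [Function.update_of_ne h]
    cases b
    · cases r with
      | lim x =>
        have : x ≠ v := by rintro rfl; exact h rfl
        simp [layout, this]
      | _ => rfl
    · cases r <;> rfl

theorem setReg_layout_tape (C : ℕ) (ν lim : V → ℕ) (g : Option T → List Bool) (t : Option T)
    (l : List Bool) :
    setReg (layout (J := J) C ν lim g) (.tape t) (l, []) =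
      layout C ν lim (Function.update g t l) := by
  funext ⟨r, b⟩
  by_cases h : r = Reg.tape t
  · subst h; cases b <;> simp [layout]
  · rw [setReg_of_ne _ h]
    cases b
    · cases r with
      | tape x =>
        have : x ≠ t := by rintro rfl; exact h rfl
        simp [layout, this]
      | _ => rfl
    · cases r <;> rfl

/-- The tapes together with the flag that says whether they have changed. -/
abbrev Tapes (T : Type) := (Option T → List Bool) × Bool

/-- `Realizes vs P β`: in polynomial time, the program `P` transforms the tapes by `β`. Here the
variables in `vs` have the value zero initially, and they range over the numbers less than `B` in
the program. -/
def Realizes (vs : List V) (P : StackProg (Reg V T J × Bool))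
    (β : ℕ → ℕ → (V → ℕ) → Tapes T → Tapes T) : Prop :=
  ∃ p : Polynomial ℕ, ∀ (n B C : ℕ) (ν lim : V → ℕ) (x : Tapes T), C ≤ n → B ≤ n →
    (∀ v, ν v ≤ n) → (∀ t, (x.1 t).length ≤ n) → (∀ v ∈ vs, ν v = 0 ∧ lim v = B) →
    Within P (mem x.2) (layout C ν lim x.1) (mem (β B C ν x).2) (layout C ν lim (β B C ν x).1)
      (p.eval n)

/-- The transformation `β` does not change the lengths of the tapes. -/
def KeepsLength (β : ℕ → ℕ → (V → ℕ) → Tapes T → Tapes T) : Prop :=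
  ∀ B C ν x t, ((β B C ν x).1 t).length = (x.1 t).length

theorem Realizes.seq {vs : List V} {P Q : StackProg (Reg V T J × Bool)} {β γ}
    (hP : Realizes vs P β) (hQ : Realizes vs Q γ) (hβ : KeepsLength β) :
    Realizes vs (seq P Q) fun B C ν x => γ B C ν (β B C ν x) := by
  obtain ⟨p, hp⟩ := hP
  obtain ⟨q, hq⟩ := hQ
  refine ⟨p + q, fun n B C ν lim x hC hB hν hx hvs => ?_⟩
  exact (Within.seq (hp n B C ν lim x hC hB hν hx hvs) (hq n B C ν lim _ hC hB hν
    (fun t => (hβ B C ν x t).le.trans (hx t)) hvs)).mono (by simp)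

/-- Run `P` for all values of the variable `v`. -/
def forVar (v : V) (P : StackProg (Reg V T J × Bool)) : StackProg (Reg V T J × Bool) :=
  seq (popLoop (.lim v, false) (seq (load fun m => { m with top := none })
    (seq P (push (.val v, false) fun _ => true))))
    (popLoop (.val v, false) (seq (push (.lim v, false) fun _ => true)
      (load fun m => { m with top := none })))

/-- The transformation that corresponds to a loop over the values of a variable. -/
def forVarFun (v : V) (β : ℕ → ℕ → (V → ℕ) → Tapes T → Tapes T) :
    ℕ → ℕ → (V → ℕ) → Tapes T → Tapes T :=
  fun B C ν x => (List.range B).foldl (fun x i => β B C (Function.update ν v i) x) x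

/-- Each round transfers one unit from `lim v` to `val v`, so the value of `v` runs through the
numbers below `B` while the sum stays `B`. The second loop transfers everything back; restoring the
counters is what allows such loops to be nested and put in sequence. -/
theorem Realizes.forVar {vs : List V} {P : StackProg (Reg V T J × Bool)} {β}
    (hP : Realizes vs P β) (hβ : KeepsLength β) {v : V} (hv : v ∉ vs) :
    Realizes (v :: vs) (forVar v P) (forVarFun v β) := by
  obtain ⟨p, hp⟩ := hP
  refine ⟨Polynomial.X * (p + 3) + 1 + (Polynomial.X * 3 + 1),
    fun n B C ν lim x hC hB hν hx hvs => ?_⟩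
  have h₁ : ∀ (m i : ℕ) (x : Tapes T), i + m = B → (∀ t, (x.1 t).length ≤ n) →
      Within (popLoop (.lim v, false) (StackProg.seq (load fun m => { m with top := none })
        (StackProg.seq P (push (.val v, false) fun _ => true)))) (mem x.2)
        (layout C (Function.update ν v i) (Function.update lim v m) x.1)
        (mem ((List.range' i m).foldl (fun x i => β B C (Function.update ν v i) x) x).2)
        (layout C (Function.update ν v B) (Function.update lim v 0)
          ((List.range' i m).foldl (fun x i => β B C (Function.update ν v i) x) x).1)
        (m * (p.eval n + 3) + 1) := by
    intro m
    induction m with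
    | zero =>
      intro i x hi hx
      obtain rfl : i = B := by omega
      exact (within_popLoop_nil (by simp [layout])).cast rfl rfl (by simp)
    | succ m ih =>
      intro i x hi hx
      set y := β B C (Function.update ν v i) x with hy
      have e₁ : layout (J := J) C (Function.update ν v i) (Function.update lim v (m + 1)) x.1
          (.lim v, false) = true :: List.replicate m true := by
        simp [layout, List.replicate_succ]
      have h : Within (StackProg.seq (load fun m => { m with top := none })
          (StackProg.seq P (push (.val v, false) fun _ => true)))
          { mem x.2 with top := some true }
          (Function.update (layout C (Function.update ν v i) (Function.update lim v (m + 1)) x.1)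
            (.lim v, false) (List.replicate m true)) (mem y.2)
          (layout C (Function.update ν v (i + 1)) (Function.update lim v m) y.1)
          (1 + (p.eval n + 1)) := by
        rw [update_layout_lim, Function.update_idem]
        refine Within.seq (within_load _ _ _) (Within.seq
          (hp n B C (Function.update ν v i) (Function.update lim v m) x hC hB ?_ hx ?_)
          ((within_push _ _ _ _).cast rfl ?_ le_rfl))
        · intro w
          by_cases hw : w = v
          · subst hw; simp; omega
          · rw [Function.update_of_ne hw]; exact hν w
        · intro w hw
          have hwv : w ≠ v := fun h => hv (h ▸ hw)
          rw [Function.update_of_ne hwv, Function.update_of_ne hwv]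
          exact hvs w (by simp [hw])
        · have : layout (J := J) C (Function.update ν v i) (Function.update lim v m) y.1
            (.val v, false) = List.replicate i true := by simp [layout]
          rw [← hy, this, ← List.replicate_succ, update_layout_val, Function.update_idem]
      refine (Within.popLoop_cons e₁ h (ih (i + 1) y (by omega)
        fun t => (hβ B C _ x t).le.trans (hx t))).cast rfl rfl ?_
      ring_nf; omega
  have h₂ : ∀ (m i : ℕ) (y : Tapes T), i + m = B →
      Within (popLoop (.val v, false) (StackProg.seq (push (.lim v, false) fun _ => true)
        (load fun m => { m with top := none }))) (mem y.2)
        (layout (J := J) C (Function.update ν v m) (Function.update lim v i) y.1)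
        (mem y.2) (layout C (Function.update ν v 0) (Function.update lim v B) y.1)
        (m * 3 + 1) := by
    intro m
    induction m with
    | zero =>
      intro i y hi
      obtain rfl : i = B := by omega
      exact (within_popLoop_nil (by simp [layout])).cast rfl rfl (by simp)
    | succ m ih =>
      intro i y hi
      refine (Within.popLoop_cons (n := 2) (a := true) (l := List.replicate m true) ?_ ?_
        (ih (i + 1) y (by omega))).cast rfl rfl (by omega)
      · simp [layout, List.replicate_succ]
      · rw [update_layout_val, Function.update_idem]
        refine Within.seq (n := 1) (m := 1) (within_push _ _ _ _)
          ((within_load _ _ _).cast rfl ?_ le_rfl)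
        have : layout (J := J) C (Function.update ν v m) (Function.update lim v i) y.1
          (.lim v, false) = List.replicate i true := by simp [layout]
        rw [this, ← List.replicate_succ, update_layout_lim, Function.update_idem]
  have hv₀ := hvs v (by simp)
  have e₁ : Function.update ν v 0 = ν := by rw [← hv₀.1, Function.update_eq_self]
  have e₂ : Function.update lim v B = lim := by rw [← hv₀.2, Function.update_eq_self]
  have k₁ := h₁ B 0 x (by omega) hx
  have k₂ := h₂ B 0 ((List.range' 0 B).foldl (fun x i => β B C (Function.update ν v i) x) x)
    (by omega)
  rw [e₁, e₂] at k₁ k₂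
  rw [← List.range_eq_range'] at k₁ k₂
  refine (Within.seq k₁ k₂).cast rfl rfl ?_
  simp only [Polynomial.eval_add, Polynomial.eval_mul, Polynomial.eval_X, Polynomial.eval_ofNat,
    Polynomial.eval_one]
  gcongr

end Sweep

end StackProg

/-! ### Application of rules and saturation -/

/-- The literals of a rule, as the symbols expected at certain positions of the tapes. -/
def HornRule.lits {V T : Type} (ρ : HornRule V T) : List (Option T × List (RuleTerm V) × Bool) :=
  ρ.inputs.map (fun l => (none, [l.1], l.2)) ++ ρ.body.map fun l => (some l.1, l.2, true)

namespace StackProg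

section Rules

variable {V T : Type} {J : ℕ} [DecidableEq V] [DecidableEq T]

/-- Whether a literal holds. -/
def holdsLit (C : ℕ) (ν : V → ℕ) (g : Option T → List Bool)
    (l : Option T × List (RuleTerm V) × Bool) : Bool :=
  (g l.1)[Nat.ofDigits C (l.2.1.map (RuleTerm.val ν))]? == some l.2.2

/-- Test a list of literals. -/
def testAll (bs : List (Fin J)) (ls : List (Option T × List (RuleTerm V) × Bool)) :
    StackProg (Reg V T J × Bool) :=
  ls.foldr (fun l P => seq (testTape bs l.1 l.2.1 l.2.2) P) skip

theorem within_testAll (bs : List (Fin J)) (hbs : bs.Nodup)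
    (ls : List (Option T × List (RuleTerm V) × Bool))
    (hl : ∀ l ∈ ls, l.2.1.length ≤ bs.length) : ∃ p : Polynomial ℕ,
    ∀ (n C : ℕ) (ν lim : V → ℕ) (g : Option T → List Bool) (v : Mem), C ≤ n → (∀ v, ν v ≤ n) →
    v.top = none → (∀ t, (g t).length ≤ n) →
    Within (testAll bs ls) v (layout C ν lim g) { v with ok := v.ok && ls.all (holdsLit C ν g) }
      (layout C ν lim g) (p.eval n) := by
  induction ls with
  | nil => exact ⟨1, fun n C ν lim g v _ _ _ _ => (within_skip _ _).cast (by simp) rfl (by simp)⟩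
  | cons l ls ih =>
    obtain ⟨p, hp⟩ := within_testTape bs hbs l.1 l.2.1 l.2.2 (hl l (by simp))
    obtain ⟨q, hq⟩ := ih fun l' hl' => hl l' (by simp [hl'])
    refine ⟨p + q, fun n C ν lim g v hC hν hv hg => ?_⟩
    refine (Within.seq (hp n C ν _ v hC hν hv (countersOK_layout C ν lim g bs) (hg l.1) rfl)
      (hq n C ν lim g _ hC hν hv hg)).cast ?_ rfl (by simp)
    simp [holdsLit, layout, Bool.and_assoc]

/-- Apply a rule for the values of the variables stored at present. -/
def ruleProg (J : ℕ) (ρ : HornRule V T) : StackProg (Reg V T J × Bool) :=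
  seq (load fun v => { v with ok := true }) (seq (testAll (List.finRange J) ρ.lits)
    (seq (ite (fun v => v.ok) (setTape (List.finRange J) (some ρ.head.1) ρ.head.2) skip)
      (load fun v => { v with ok := false })))

/-- The effect of a rule on the tapes. -/
def applyRule (C : ℕ) (x : Tapes T) (s : HornRule V T × (V → ℕ)) : Tapes T :=
  if s.1.lits.all (holdsLit C s.2 x.1) then
    let i := Nat.ofDigits C (s.1.head.2.map (RuleTerm.val s.2))
    (Function.update x.1 (some s.1.head.1) ((x.1 (some s.1.head.1)).set i true),
      x.2 || ((x.1 (some s.1.head.1))[i]? == some false))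
  else x

omit [DecidableEq V] in
theorem length_applyRule (C : ℕ) (x : Tapes T) (s : HornRule V T × (V → ℕ)) (t : Option T) :
    ((applyRule C x s).1 t).length = (x.1 t).length := by
  unfold applyRule
  split_ifs
  · by_cases h : t = some s.1.head.1
    · subst h; simp
    · simp [Function.update_of_ne h]
  · rfl

theorem realizes_ruleProg (ρ : HornRule V T) (hρ : ∀ l ∈ ρ.lits, l.2.1.length ≤ J)
    (hh : ρ.head.2.length ≤ J) :
    Realizes [] (ruleProg J ρ) fun _ C ν x => applyRule C x (ρ, ν) := by
  have hJ : (List.finRange J).length = J := List.length_finRange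
  obtain ⟨p, hp⟩ := within_testAll (List.finRange J) (List.nodup_finRange J) ρ.lits
    (by simpa [hJ] using hρ)
  obtain ⟨q, hq⟩ := within_setTape (List.finRange J) (List.nodup_finRange J) (some ρ.head.1)
    ρ.head.2 (by simpa [hJ] using hh)
  refine ⟨1 + (p + ((1 + (q + 1)) + 1)), fun n B C ν lim x hC _ hν hx _ => ?_⟩
  set S := layout (J := J) C ν lim x.1 with hS
  have key : ∃ v : Mem, Within (ite (fun v => v.ok) (setTape (List.finRange J) (some ρ.head.1)
      ρ.head.2) skip) ⟨none, true && ρ.lits.all (holdsLit C ν x.1), x.2⟩ S v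
      (layout C ν lim (applyRule C x (ρ, ν)).1) (1 + (q.eval n + 1)) ∧
      { v with ok := false } = mem (applyRule C x (ρ, ν)).2 := by
    cases h : ρ.lits.all (holdsLit C ν x.1)
    · exact ⟨_, (Within.ite_false rfl (within_skip _ _)).cast rfl (by simp [applyRule, h, hS])
        (by omega), by simp [applyRule, h, mem]⟩
    · refine ⟨_, (Within.ite_true rfl (hq n C ν S _ hC hν rfl (countersOK_layout C ν lim x.1 _)
        (hx (some ρ.head.1)) rfl)).cast rfl ?_ (by omega), ?_⟩
      · rw [hS, setReg_layout_tape]; simp [applyRule, h, layout]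
      · simp [applyRule, h, mem, hS, layout]
  obtain ⟨v, hw, hv⟩ := key
  refine (Within.seq (within_load _ _ _) (Within.seq (hp n C ν lim x.1 _ hC hν rfl hx)
    (Within.seq hw (within_load _ _ _)))).cast hv rfl (by simp)

/-- The valuations that differ from `ν` only on the variables in the list, which have values less
than `B`. -/
def valuations (B : ℕ) : List V → (V → ℕ) → List (V → ℕ)
  | [], ν => [ν]
  | v :: vs, ν => (List.range B).flatMap fun i => valuations B vs (Function.update ν v i)

omit [DecidableEq T] in
theorem mem_valuations {B : ℕ} {vs : List V} {ν ν' : V → ℕ} (h : ∀ v ∈ vs, ν' v < B)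
    (h' : ∀ v ∉ vs, ν' v = ν v) : ν' ∈ valuations B vs ν := by
  induction vs generalizing ν with
  | nil => simp [valuations, funext fun v => h' v (by simp)]
  | cons v vs ih =>
    simp only [valuations, List.mem_flatMap, List.mem_range]
    refine ⟨ν' v, h v (by simp), ih (fun w hw => h w (by simp [hw])) fun w hw => ?_⟩
    by_cases hwv : w = v
    · subst hwv; simp
    · rw [Function.update_of_ne hwv]; exact h' w (by simp [hwv, hw])

omit [DecidableEq T] in
theorem lt_of_mem_valuations {B : ℕ} {vs : List V} {ν ν' : V → ℕ} (h : ν' ∈ valuations B vs ν)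
    (v : V) : (v ∈ vs → ν' v < B) ∧ (v ∉ vs → ν' v = ν v) := by
  induction vs generalizing ν with
  | nil => simp_all [valuations]
  | cons w vs ih =>
    simp only [valuations, List.mem_flatMap, List.mem_range] at h
    obtain ⟨i, hi, h⟩ := h
    have := ih h
    by_cases hv : v ∈ vs
    · simp [hv, this.1 hv]
    · by_cases hvw : v = w
      · subst hvw; simp [this.2 hv, hi]
      · simp [hv, hvw, this.2 hv]

/-- Apply a rule for all values of the variables in a list. -/
def forVars (vs : List V) (P : StackProg (Reg V T J × Bool)) : StackProg (Reg V T J × Bool) :=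
  vs.foldr forVar P

/-- The effect of a rule, applied for all values of the variables in a list. -/
def forVarsFun (vs : List V) (ρ : HornRule V T) (B C : ℕ) (ν : V → ℕ) (x : Tapes T) : Tapes T :=
  ((valuations B vs ν).map fun ν => (ρ, ν)).foldl (applyRule C) x

omit [DecidableEq V] in
theorem length_foldl_applyRule (C : ℕ) (x : Tapes T) (l : List (HornRule V T × (V → ℕ)))
    (t : Option T) : ((l.foldl (applyRule C) x).1 t).length = (x.1 t).length := by
  induction l generalizing x with
  | nil => rfl
  | cons s l ih => rw [List.foldl_cons, ih, length_applyRule]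

theorem realizes_forVars (ρ : HornRule V T) (hρ : ∀ l ∈ ρ.lits, l.2.1.length ≤ J)
    (hh : ρ.head.2.length ≤ J) (vs : List V) (hvs : vs.Nodup) :
    Realizes vs (forVars vs (ruleProg J ρ)) (forVarsFun vs ρ) := by
  induction vs with
  | nil =>
    have e : forVarsFun [] ρ = fun _ C ν x => applyRule C x (ρ, ν) := by
      funext B C ν x; simp [forVarsFun, valuations]
    rw [e]
    exact realizes_ruleProg ρ hρ hh
  | cons v vs ih =>
    have := (ih (List.nodup_cons.1 hvs).2).forVar (fun B C ν x t => length_foldl_applyRule ..)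
      (List.nodup_cons.1 hvs).1
    convert! this using 1
    funext B C ν x
    simp only [forVarsFun, valuations, forVarFun, List.map_flatMap, List.foldl_flatMap]

/-- Apply all rules of a program for all values of the variables. -/
def sweepProg (J : ℕ) (vs : List V) (rs : List (HornRule V T)) : StackProg (Reg V T J × Bool) :=
  rs.foldr (fun ρ P => seq (forVars vs (ruleProg J ρ)) P) skip

/-- The pairs of rules and valuations considered in one sweep. -/
def sweepSteps (vs : List V) (rs : List (HornRule V T)) (B : ℕ) (ν : V → ℕ) :
    List (HornRule V T × (V → ℕ)) :=
  rs.flatMap fun ρ => (valuations B vs ν).map fun ν => (ρ, ν)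

theorem realizes_sweepProg (vs : List V) (hvs : vs.Nodup) (rs : List (HornRule V T))
    (hρ : ∀ ρ ∈ rs, ∀ l ∈ ρ.lits, l.2.1.length ≤ J) (hh : ∀ ρ ∈ rs, ρ.head.2.length ≤ J) :
    Realizes vs (sweepProg J vs rs) fun B C ν x =>
      (sweepSteps vs rs B ν).foldl (applyRule C) x := by
  induction rs with
  | nil => exact ⟨1, fun n B C ν lim x _ _ _ _ _ => (within_skip _ _).cast rfl rfl (by simp)⟩
  | cons ρ rs ih =>
    have := (realizes_forVars ρ (hρ ρ (by simp)) (hh ρ (by simp)) vs hvs).seq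
      (ih (fun ρ h => hρ ρ (by simp [h])) fun ρ h => hh ρ (by simp [h]))
      (fun B C ν x t => length_foldl_applyRule ..)
    convert! this using 1
    funext B C ν x
    simp [sweepSteps, forVarsFun]

/-- Apply all rules until nothing changes any more. -/
def saturateProg (J : ℕ) (vs : List V) (rs : List (HornRule V T)) : StackProg (Reg V T J × Bool) :=
  seq (load fun v => { v with changed := true }) (loopWhile (fun v => v.changed)
    (seq (load fun v => { v with changed := false }) (sweepProg J vs rs)))

section Measure

variable [Fintype T]

/-- The number of facts not yet derived. -/
def missing (g : Option T → List Bool) : ℕ := ∑ t : T, (g (some t)).count false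

-- A rule changes at most one cell, from `false` to `true`, and raises the flag when it does. Hence
-- a rule either has no effect at all or makes measurable progress.
omit [DecidableEq V] in
theorem applyRule_eq_or (C : ℕ) (x : Tapes T) (s : HornRule V T × (V → ℕ)) :
    applyRule C x s = x ∨ (applyRule C x s).2 = true ∧ missing (applyRule C x s).1 < missing x.1 := by
  unfold applyRule
  split_ifs
  swap
  · exact Or.inl rfl
  set t := s.1.head.1
  set i := Nat.ofDigits C (s.1.head.2.map (RuleTerm.val s.2))
  have hcount : ∀ (l : List Bool) (i : ℕ), (l[i]? = some false → (l.set i true).count false <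
      l.count false) ∧ (l[i]? ≠ some false → l.set i true = l) := by
    intro l
    induction l with
    | nil => simp
    | cons a l ih =>
      rintro (_ | i)
      · cases a <;> simp
      · have := ih i
        simp only [List.getElem?_cons_succ, List.set_cons_succ, List.count_cons, ne_eq,
          List.cons.injEq, true_and] at this ⊢
        exact ⟨fun h => by have := this.1 h; omega, this.2⟩
  by_cases h : (x.1 (some t))[i]? = some false
  · refine Or.inr ⟨by simp [h], ?_⟩
    unfold missing
    refine Finset.sum_lt_sum (fun u _ => ?_) ⟨t, Finset.mem_univ t, ?_⟩
    · by_cases hu : u = t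
      · subst hu; simpa using ((hcount _ i).1 h).le
      · simp [hu]
    · simpa using (hcount _ i).1 h
  · left
    have := (hcount _ i).2 h
    simp only [this, Function.update_eq_self]
    exact Prod.ext rfl (by simp [h])

omit [DecidableEq V] in
theorem foldl_applyRule_eq_or (C : ℕ) (x : Tapes T) (l : List (HornRule V T × (V → ℕ))) :
    (l.foldl (applyRule C) x = x ∧ ∀ s ∈ l, applyRule C x s = x) ∨
      (l.foldl (applyRule C) x).2 = true ∧ missing (l.foldl (applyRule C) x).1 < missing x.1 := by
  induction l generalizing x with
  | nil => simp
  | cons s l ih =>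
    rw [List.foldl_cons]
    rcases applyRule_eq_or C x s with h | h
    · rw [h]
      rcases ih x with h' | h'
      · exact Or.inl ⟨h'.1, by simpa [h] using h'.2⟩
      · exact Or.inr h'
    · rcases ih (applyRule C x s) with h' | h'
      · rw [h'.1]; exact Or.inr h
      · exact Or.inr ⟨h'.1, h'.2.trans h.2⟩

/-- Every sweep but the last lowers `missing`, which is at most the number of relation symbols times
`n`. The last sweep changes nothing, so the final tapes are closed under all rules. The invariant
`Inv` is a parameter for the sake of soundness. -/
theorem within_saturateProg (vs : List V) (hvs : vs.Nodup) (rs : List (HornRule V T))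
    (hρ : ∀ ρ ∈ rs, ∀ l ∈ ρ.lits, l.2.1.length ≤ J) (hh : ∀ ρ ∈ rs, ρ.head.2.length ≤ J) :
    ∃ p : Polynomial ℕ, ∀ (n B C : ℕ) (ν lim : V → ℕ) (g : Option T → List Bool)
    (Inv : (Option T → List Bool) → Prop), C ≤ n → B ≤ n →
    (∀ v, ν v ≤ n) → (∀ t, (g t).length ≤ n) → (∀ v ∈ vs, ν v = 0 ∧ lim v = B) → Inv g →
    (∀ (x : Tapes T), ∀ s ∈ sweepSteps vs rs B ν, Inv x.1 → Inv (applyRule C x s).1) →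
    ∃ g' : Option T → List Bool, Inv g' ∧ (∀ t, (g' t).length = (g t).length) ∧
      (∀ s ∈ sweepSteps vs rs B ν, applyRule C (g', false) s = (g', false)) ∧
      Within (saturateProg J vs rs) (mem false) (layout C ν lim g) (mem false) (layout C ν lim g')
        (p.eval n) := by
  obtain ⟨p, hp⟩ := realizes_sweepProg vs hvs rs hρ hh
  refine ⟨1 + (((Fintype.card T : Polynomial ℕ) * Polynomial.X + 1) * (p + 2) + 1),
    fun n B C ν lim g Inv hC hB hν hg hlim hInv hpres => ?_⟩
  have hpres' : ∀ (l : List (HornRule V T × (V → ℕ))), (∀ s ∈ l, s ∈ sweepSteps vs rs B ν) →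
      ∀ x : Tapes T, Inv x.1 → Inv (l.foldl (applyRule C) x).1 := by
    intro l hl
    induction l with
    | nil => exact fun _ h => h
    | cons s l ih =>
      exact fun x hx => ih (fun s hs => hl s (by simp [hs])) _ (hpres x s (hl s (by simp)) hx)
  have key : ∀ (k : ℕ) (g : Option T → List Bool), missing g ≤ k → (∀ t, (g t).length ≤ n) →
      Inv g → ∃ g' : Option T → List Bool, Inv g' ∧ (∀ t, (g' t).length = (g t).length) ∧
      (∀ s ∈ sweepSteps vs rs B ν, applyRule C (g', false) s = (g', false)) ∧
      Within (loopWhile (fun v => v.changed) (seq (load fun v => { v with changed := false })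
        (sweepProg J vs rs))) (mem true) (layout C ν lim g) (mem false) (layout C ν lim g')
        ((k + 1) * (p.eval n + 2) + 1) := by
    intro k
    induction k with
    | zero =>
      intro g hk hg hInv
      have hw := hp n B C ν lim (g, false) hC hB hν hg hlim
      rcases foldl_applyRule_eq_or C (g, false) (sweepSteps vs rs B ν) with h | h
      · simp only [h.1] at hw
        refine ⟨g, hInv, fun _ => rfl, h.2, ?_⟩
        exact (Within.loopWhile_true rfl (Within.seq (within_load _ _ _) hw)
          (within_loopWhile_false rfl)).mono (by omega)
      · simp only at h; omega
    | succ k ih =>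
      intro g hk hg hInv
      have hw := hp n B C ν lim (g, false) hC hB hν hg hlim
      rcases foldl_applyRule_eq_or C (g, false) (sweepSteps vs rs B ν) with h | h
      · simp only [h.1] at hw
        refine ⟨g, hInv, fun _ => rfl, h.2, ?_⟩
        refine (Within.loopWhile_true rfl (Within.seq (within_load _ _ _) hw)
          (within_loopWhile_false rfl)).mono ?_
        ring_nf; omega
      · set y := (sweepSteps vs rs B ν).foldl (applyRule C) (g, false) with hy
        have hlen : ∀ t, (y.1 t).length = (g t).length := fun t => length_foldl_applyRule ..
        obtain ⟨g', h₁, h₂, h₃, h₄⟩ := ih y.1 (by have := h.2; simp only at this; omega)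
          (fun t => (hlen t).le.trans (hg t)) (hpres' _ (fun _ h => h) _ hInv)
        refine ⟨g', h₁, fun t => (h₂ t).trans (hlen t), h₃, ?_⟩
        simp only [← hy, h.1] at hw
        refine (Within.loopWhile_true rfl (Within.seq (within_load _ _ _) hw) h₄).mono ?_
        ring_nf; omega
  have hm : missing g ≤ Fintype.card T * n := by
    unfold missing
    refine (Finset.sum_le_card_nsmul _ _ n fun t _ => (List.count_le_length.trans (hg _))).trans ?_
    simp
  obtain ⟨g', h₁, h₂, h₃, h₄⟩ := key _ g hm hg hInv
  exact ⟨g', h₁, h₂, h₃, (Within.seq (within_load _ _ _) h₄).mono (by simp)⟩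

end Measure

end Rules

end StackProg

/-! ### Initialisation of the counters and tapes -/

namespace StackProg

section Init

variable {K : Type} [DecidableEq K]

/-- Push the symbol `true` on all stacks in a list. -/
def pushAll (ks : List K) : StackProg K := ks.foldr (fun k P => seq (push k fun _ => true) P) skip

theorem within_pushAll (ks : List K) (hks : ks.Nodup) (v : Mem) (S : K → List Bool) :
    Within (pushAll ks) v S v (fun k => if k ∈ ks then true :: S k else S k) (ks.length + 1) := by
  induction ks generalizing S with
  | nil => exact (within_skip v S).cast rfl (by simp) le_rfl
  | cons k ks ih =>
    refine (Within.seq (within_push _ _ _ _) (ih (List.nodup_cons.1 hks).2 _)).cast rfl ?_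
      (by simp; omega)
    funext k'
    by_cases h : k' = k
    · subst h; simp [(List.nodup_cons.1 hks).1]
    · simp [h]

/-- Clear all stacks in a list. -/
def clearAll (ks : List K) : StackProg K := ks.foldr (fun k P => seq (popLoop k skip) P) skip

theorem within_clear (k : K) (v : Mem) (S : K → List Bool) :
    Within (popLoop k skip) v S { v with top := none } (Function.update S k [])
      (2 * (S k).length + 1) := by
  generalize hl : S k = l
  induction l generalizing v S with
  | nil => exact (within_popLoop_nil hl).cast rfl (by rw [← hl, Function.update_eq_self]) le_rfl
  | cons a l ih =>
    exact (Within.popLoop_cons hl (within_skip _ _) (ih _ _ (by simp))).cast rfl (by simp)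
      (by simp; omega)

theorem within_clearAll (ks : List K) (n : ℕ) (v : Mem) (hv : v.top = none) (S : K → List Bool)
    (hS : ∀ k, (S k).length ≤ n) :
    Within (clearAll ks) v S v (fun k => if k ∈ ks then [] else S k)
      (ks.length * (2 * n + 1) + 1) := by
  induction ks generalizing S with
  | nil => exact (within_skip v S).cast rfl (by simp) (by simp)
  | cons k ks ih =>
    have hv' : { v with top := none } = v := by rw [← hv]
    have h := (within_clear k v S).cast hv' rfl
      (Nat.add_le_add_right (Nat.mul_le_mul_left 2 (hS k)) 1)
    refine (Within.seq h (ih _ fun k' => ?_)).cast rfl ?_ ?_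
    · by_cases h : k' = k
      · subst h; simp
      · simp [h, hS]
    · funext k'
      by_cases h : k' = k
      · subst h; simp
      · simp [h]
    · rw [List.length_cons]; ring_nf; omega

end Init

section Main

variable {V T : Type} {J : ℕ} [DecidableEq V] [DecidableEq T]

/-- Push `C ^ k` zeros on a tape, where `C` is the base and `k` the length of the list. -/
def fill (t : Option T) : List (Fin J) → StackProg (Reg V T J × Bool)
  | [] => push (.tape t, false) fun _ => false
  | b :: bs => loop (.base b) (fill t bs)

/-- Nested loops multiply their numbers of rounds, which yields the power of `C`. -/
theorem within_fill (t : Option T) (bs : List (Fin J)) (hbs : bs.Nodup) : ∃ p : Polynomial ℕ,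
    ∀ (n C : ℕ) (ν : V → ℕ) (S : Reg V T J × Bool → List Bool) (v : Mem),
    C ≤ n → v.top = none → CountersOK C ν bs S →
    Within (fill t bs) v S v
      (act (.tape t) (fun x => (false :: x.1, x.2))^[C ^ bs.length] S) (p.eval n) := by
  induction bs with
  | nil =>
    refine ⟨1, fun n C ν S v _ _ _ => (within_push _ _ _ _).cast rfl ?_ (by simp)⟩
    rw [update_main]; simp [act, getReg]
  | cons b bs ih =>
    obtain ⟨q, hq⟩ := ih (List.nodup_cons.1 hbs).2
    refine ⟨Polynomial.X * (q + 5) + 2, fun n C ν S v hC hv hS => ?_⟩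
    have hb := hS.2 b (by simp)
    refine (within_loop (.base b) (.tape t) (by simp) _ v hv
      _ (q.eval n) S hb.2 fun S' hS' => hq n C ν S' v hC hv ?_).cast rfl ?_ ?_
    · constructor
      · intro x
        rw [hS' _ (by simp) (by simp), hS' _ (by simp) (by simp)]
        exact hS.1 x
      · intro b' hb'
        have hne : b' ≠ b := fun h => (List.nodup_cons.1 hbs).1 (h ▸ hb')
        rw [hS' _ (by simpa using hne) (by simp), hS' _ (by simpa using hne) (by simp)]
        exact hS.2 b' (by simp [hb'])
    · rw [hb.1, List.length_replicate, ← Function.iterate_mul, List.length_cons, pow_succ]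
    · rw [hb.1, List.length_replicate]
      simp only [Polynomial.eval_add, Polynomial.eval_mul, Polynomial.eval_X, Polynomial.eval_ofNat]
      gcongr

/-- Fill the tapes of all relation symbols with zeros. -/
def fillAll (J : ℕ) (ar : T → ℕ) (ts : List T) : StackProg (Reg V T J × Bool) :=
  ts.foldr (fun t P => seq (fill (some t) ((List.finRange J).take (ar t))) P) skip

/-- The empty tapes next to the input. -/
def initialTapes (C : ℕ) (ar : T → ℕ) (w : List Bool) : Option T → List Bool
  | none => w
  | some t => List.replicate (C ^ ar t) false

theorem within_fillAll (ar : T → ℕ) (har : ∀ t, ar t ≤ J) (ts : List T) (hts : ts.Nodup) :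
    ∃ p : Polynomial ℕ, ∀ (n C : ℕ) (ν lim : V → ℕ) (g : Option T → List Bool) (v : Mem),
    C ≤ n → v.top = none → (∀ t ∈ ts, g (some t) = []) →
    Within (fillAll J ar ts) v (layout C ν lim g) v (layout C ν lim fun u =>
      if ∃ t ∈ ts, u = some t then initialTapes C ar [] u else g u) (p.eval n) := by
  induction ts with
  | nil => exact ⟨1, fun n C ν lim g v _ _ _ => (within_skip _ _).cast rfl (by simp) (by simp)⟩
  | cons t ts ih =>
    obtain ⟨q, hq⟩ := ih (List.nodup_cons.1 hts).2
    obtain ⟨p, hp⟩ := within_fill (V := V) (some t) ((List.finRange J).take (ar t))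
      ((List.nodup_finRange J).sublist (List.take_sublist _ _))
    refine ⟨p + q, fun n C ν lim g v hC hv hg => ?_⟩
    have hpush : ∀ (m : ℕ) (x : List Bool × List Bool),
        (fun x : List Bool × List Bool => (false :: x.1, x.2))^[m] x =
          (List.replicate m false ++ x.1, x.2) := by
      intro m
      induction m with
      | zero => simp
      | succ m ih => intro x; rw [Function.iterate_succ_apply', ih, List.replicate_succ]; rfl
    have h₁ : Within (fill (some t) ((List.finRange J).take (ar t))) v (layout C ν lim g) v
        (layout C ν lim (Function.update g (some t) (List.replicate (C ^ ar t) false)))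
        (p.eval n) := by
      refine (hp n C ν _ v hC hv (countersOK_layout ..)).cast rfl ?_ le_rfl
      rw [act, hpush, List.length_take, List.length_finRange, min_eq_left (har t)]
      convert! setReg_layout_tape C ν lim g (some t) _ using 2
      simp [getReg, layout, hg t]
    refine (Within.seq h₁ (hq n C ν lim _ v hC hv fun u hu => ?_)).cast rfl ?_ (by simp)
    · have hut : u ≠ t := fun h => (List.nodup_cons.1 hts).1 (h ▸ hu)
      rw [Function.update_of_ne (by simpa using hut)]
      exact hg u (by simp [hu])
    · congr 1
      funext u
      by_cases hu : u = some t
      · subst hu; simp [initialTapes]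
      · simp [hu]

/-- The stacks that hold the base or the number of values of a variable. -/
def isCounter : Reg V T J × Bool → Bool
  | (.lim _, false) => true
  | (.base _, false) => true
  | _ => false

/-- The stacks that hold the base. -/
def isBase : Reg V T J × Bool → Bool
  | (.base _, false) => true
  | _ => false

variable [Fintype V] [Fintype T]

/-- Prepare the counters and the tapes. -/
noncomputable def initProg (J d : ℕ) (ar : T → ℕ) : StackProg (Reg V T J × Bool) :=
  seq (popLoop (.tape none, false) (seq (push (.tape none, true) fun v => v.top.getD false)
    (pushAll (Finset.univ.toList.filter isCounter))))
  (seq (rewind (.tape none))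
  (seq (pushAll (Finset.univ.toList.filter isCounter))
  (seq (iter (pushAll (Finset.univ.toList.filter isBase)) (d + 1))
  (fillAll J ar Finset.univ.toList))))

/-- One pass over the input adds a unit to every counter for each symbol, so that all counters hold
the length of the word. One more unit makes the variables range up to that length inclusively; `d +
1` further units on the base registers give `w.length + d + 2`. -/
theorem within_initProg (d : ℕ) (ar : T → ℕ) (har : ∀ t, ar t ≤ J) : ∃ p : Polynomial ℕ,
    ∀ (w : List Bool), Within (initProg J d ar) (mem false)
      (Function.update (fun _ => []) ((.tape none : Reg V T J), false) w) (mem false)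
      (layout (w.length + d + 2) (fun _ => 0) (fun _ => w.length + 1)
        (initialTapes (w.length + d + 2) ar w)) (p.eval w.length) := by
  have nd : ∀ f : Reg V T J × Bool → Bool, (Finset.univ.toList.filter f).Nodup :=
    fun f => (Finset.nodup_toList _).filter f
  obtain ⟨q, hq⟩ := within_fillAll (V := V) ar har Finset.univ.toList (Finset.nodup_toList _)
  set c := (Finset.univ.toList.filter (isCounter (V := V) (T := T) (J := J))).length with hc
  set b := (Finset.univ.toList.filter (isBase (V := V) (T := T) (J := J))).length with hb
  set st : ℕ → List Bool × List Bool → Reg V T J × Bool → List Bool := fun i x =>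
    setReg (layout i (fun _ => 0) (fun _ => i) (fun _ => [])) (.tape none) x with hst
  have hstep : ∀ i x v, Within (pushAll (Finset.univ.toList.filter isCounter)) v (st i x) v
      (st (i + 1) x) (c + 1) := by
    intro i x v
    refine (within_pushAll _ (nd _) v _).cast rfl ?_ le_rfl
    funext ⟨r, b⟩
    cases r <;> cases b <;> simp [hst, setReg, layout, isCounter, List.replicate_succ]
  have h₁ : ∀ (l m : List Bool) (i : ℕ) (v : Mem),
      Within (popLoop (.tape none, false) (seq (push (.tape none, true) fun v => v.top.getD false)
        (pushAll (Finset.univ.toList.filter isCounter)))) v (st i (l, m)) { v with top := none }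
        (st (i + l.length) ([], l.reverse ++ m)) (l.length * (c + 3) + 1) := by
    intro l
    induction l with
    | nil =>
      intro m i v
      exact (within_popLoop_nil (by simp [hst])).cast rfl (by simp) (by simp)
    | cons a l ih =>
      intro m i v
      have h : Within (seq (push (.tape none, true) fun v => v.top.getD false)
          (pushAll (Finset.univ.toList.filter isCounter))) { v with top := some a }
          (Function.update (st i (a :: l, m)) (.tape none, false) l) { v with top := some a }
          (st (i + 1) (l, a :: m)) (1 + (c + 1)) := by
        refine Within.seq ((within_push _ _ _ _).cast rfl ?_ le_rfl) (hstep i (l, a :: m) _)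
        simp [hst, update_main, update_aux]
      refine (Within.popLoop_cons (by simp [hst]) h (ih (a :: m) (i + 1) _)).cast rfl ?_ ?_
      · simp only [List.length_cons, List.reverse_cons, List.append_assoc, List.singleton_append]
        congr 1; omega
      · rw [List.length_cons]; ring_nf; omega
  have h₂ : ∀ (e i : ℕ) (lim : V → ℕ) (g : Option T → List Bool) (v : Mem),
      Within (iter (pushAll (Finset.univ.toList.filter isBase)) e) v
        (layout (J := J) i (fun _ => 0) lim g) v (layout (i + e) (fun _ => 0) lim g)
        (e * (b + 1) + 1) := by
    intro e
    induction e with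
    | zero => exact fun i lim g v => (within_skip _ _).cast rfl rfl (by simp)
    | succ e ih =>
      intro i lim g v
      refine (Within.seq ((within_pushAll _ (nd _) v _).cast rfl
        (S₂ := layout (i + 1) (fun _ => 0) lim g) ?_ le_rfl) (ih (i + 1) lim g v)).cast rfl ?_ ?_
      · funext ⟨r, b⟩
        cases r <;> cases b <;> simp [layout, isBase, List.replicate_succ]
      · congr 1; omega
      · ring_nf; omega
  refine ⟨(Polynomial.X * ((c : Polynomial ℕ) + 3) + 1) + ((2 * Polynomial.X + 1) +
    (((c : Polynomial ℕ) + 1) + ((((d + 1) * (b + 1) + 1 : ℕ) : Polynomial ℕ) +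
      q.comp (Polynomial.X + ((d + 2 : ℕ) : Polynomial ℕ))))), fun w => ?_⟩
  have e₀ : Function.update (fun _ => []) ((.tape none : Reg V T J), false) w = st 0 (w, []) := by
    rw [update_main]
    simp only [hst]
    congr 1
    funext ⟨r, b⟩
    cases r <;> cases b <;> simp [layout]
  have e₁ : st (w.length + 1) (w, []) = layout (w.length + 1) (fun _ => 0) (fun _ => w.length + 1)
      (Function.update (fun _ => []) none w) := by
    rw [hst]
    exact setReg_layout_tape _ _ _ _ _ _
  have k₁ := h₁ w [] 0 (mem false)
  rw [← e₀] at k₁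
  have k₂ := (within_rewind (.tape none) (mem false) (st (0 + w.length) ([], w.reverse ++ []))).cast
    (v₂ := mem false) (S₂ := st w.length (w, [])) (m := 2 * w.length + 1) rfl
    (by simp [hst, act]) (by simp [hst])
  have k₃ := hstep w.length (w, []) (mem false)
  rw [e₁] at k₃
  have k₄ := (h₂ (d + 1) (w.length + 1) (fun _ => w.length + 1)
    (Function.update (fun _ => []) none w) (mem false)).cast rfl
    (S₂ := layout (w.length + d + 2) (fun _ => 0) (fun _ => w.length + 1)
      (Function.update (fun _ => []) none w)) (by congr 1; omega) le_rfl
  have k₅ := hq (w.length + d + 2) (w.length + d + 2) (fun _ => 0) (fun _ => w.length + 1)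
    (Function.update (fun _ => []) none w) (mem false) le_rfl rfl (by simp)
  refine (Within.seq k₁ (Within.seq k₂ (Within.seq k₃ (Within.seq k₄ k₅)))).cast rfl ?_ ?_
  · congr 1
    funext u
    cases u <;> simp [initialTapes]
  · simp [Polynomial.eval_comp, add_assoc]

end Main

end StackProg

/-! ### Correctness and running time of the evaluation of Horn programs -/

namespace HornProgram

variable {V T : Type}

/-- An upper bound for the arities, and at least one. -/
def maxArity [Fintype T] (D : HornProgram V T) : ℕ := 1 + ∑ t, D.arity t

theorem arity_le_maxArity [Fintype T] (D : HornProgram V T) (t : T) : D.arity t ≤ D.maxArity :=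
  (Finset.single_le_sum (f := D.arity) (fun _ _ => Nat.zero_le _) (Finset.mem_univ t)).trans
    (Nat.le_add_left _ _)

theorem lits_length_le [Fintype T] (D : HornProgram V T) (ρ : HornRule V T) (hρ : ρ ∈ D.rules) :
    ∀ l ∈ ρ.lits, l.2.1.length ≤ D.maxArity := by
  intro l hl
  simp only [HornRule.lits, List.mem_append, List.mem_map] at hl
  rcases hl with ⟨l, hl, rfl⟩ | ⟨l, hl, rfl⟩
  · simp [maxArity]
  · exact (D.body_arity ρ hρ l hl).le.trans (D.arity_le_maxArity _)

/-- The base of the numbering of tuples. -/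
def base (D : HornProgram V T) (w : List Bool) : ℕ := w.length + D.maxConst + 2

theorem val_lt_base (D : HornProgram V T) {w : List Bool} {ν : V → ℕ}
    (hν : ∀ v, ν v ≤ w.length) {τ : RuleTerm V} (hτ : τ.const ≤ D.maxConst) :
    τ.val ν < D.base w := by
  unfold RuleTerm.val base
  rcases τ.var with _ | v
  · simp; omega
  · have := hν v; simp; omega

/-- The entries of a derived fact are digits to the base `D.base w`, so the cell number on the tape
of its relation symbol determines the fact. -/
theorem Derives.wf {D : HornProgram V T} {w : List Bool} {t : T} {ys : List ℕ}
    (h : D.Derives w t ys) : ys.length = D.arity t ∧ ∀ y ∈ ys, y < D.base w := by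
  obtain ⟨ρ, hρ, ν, hν, -, -⟩ := h
  refine ⟨by simpa using D.head_arity ρ hρ, fun y hy => ?_⟩
  obtain ⟨τ, hτ, rfl⟩ := List.mem_map.1 hy
  exact D.val_lt_base hν (D.head_const ρ hρ τ hτ)

variable [DecidableEq T]

open StackProg

/-- The tapes contain only facts that can be derived. -/
def SoundTapes (D : HornProgram V T) (w : List Bool) (g : Option T → List Bool) : Prop :=
  g none = w ∧ ∀ (t : T) (i : ℕ), (g (some t))[i]? = some true →
    ∃ ys, D.Derives w t ys ∧ Nat.ofDigits (D.base w) ys = i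

theorem SoundTapes.applyRule {D : HornProgram V T} {w : List Bool} {x : Tapes T}
    (h : D.SoundTapes w x.1) {s : HornRule V T × (V → ℕ)} (hs : s.1 ∈ D.rules)
    (hν : ∀ v, s.2 v ≤ w.length) : D.SoundTapes w (applyRule (D.base w) x s).1 := by
  unfold StackProg.applyRule
  split_ifs with hl
  swap
  · exact h
  rw [List.all_eq_true] at hl
  have hd : D.Derives w s.1.head.1 (s.1.head.2.map (RuleTerm.val s.2)) := by
    refine .rule s.1 hs s.2 hν (fun l hl' => ?_) fun l hl' => ?_
    · have := hl (none, [l.1], l.2) (by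
        simp only [HornRule.lits, List.mem_append, List.mem_map]
        exact Or.inl ⟨l, hl', rfl⟩)
      simpa [holdsLit, h.1] using this
    · have := hl (some l.1, l.2, true) (by
        simp only [HornRule.lits, List.mem_append, List.mem_map]
        exact Or.inr ⟨l, hl', rfl⟩)
      simp only [holdsLit, beq_iff_eq] at this
      obtain ⟨ys, hys, he⟩ := h.2 _ _ this
      have : ys = l.2.map (RuleTerm.val s.2) := by
        -- Tuples of equal length with entries below the base are determined by their number. This
        -- needs a base greater than one, which the summand `2` guarantees.
        refine Nat.ofDigits_inj_of_len_eq (b := D.base w) (by unfold base; omega) ?_ hys.wf.2 ?_ he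
        · simpa [D.body_arity s.1 hs l hl'] using hys.wf.1
        · intro y hy
          obtain ⟨τ, hτ, rfl⟩ := List.mem_map.1 hy
          exact D.val_lt_base hν (D.body_const s.1 hs l hl' τ hτ)
      exact this ▸ hys
  refine ⟨by simpa using h.1, fun t i hi => ?_⟩
  by_cases ht : t = s.1.head.1
  · subst ht
    simp only [Function.update_self, List.getElem?_set] at hi
    split_ifs at hi with h1 h2
    · exact ⟨_, hd, h1⟩
    · exact h.2 _ _ hi
  · simp only [Function.update_of_ne (show some t ≠ some s.1.head.1 by simpa using ht)] at hi
    exact h.2 _ _ hi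

/-- Tapes that are closed under the rules contain all facts that can be derived. -/
theorem Derives.mem_tapes {D : HornProgram V T} {w : List Bool} {g : Option T → List Bool}
    (hw : g none = w) (hlen : ∀ t, (g (some t)).length = D.base w ^ D.arity t)
    (hg : ∀ ρ ∈ D.rules, ∀ ν : V → ℕ, (∀ v, ν v ≤ w.length) →
      StackProg.applyRule (D.base w) (g, false) (ρ, ν) = (g, false)) {t : T} {ys : List ℕ}
    (h : D.Derives w t ys) : (g (some t))[Nat.ofDigits (D.base w) ys]? = some true := by
  induction h with
  | rule ρ hρ ν hν hi hb ih =>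
    have h := hg ρ hρ ν hν
    have hd := (Derives.rule ρ hρ ν hν hi hb).wf
    rw [StackProg.applyRule, if_pos] at h
    -- The rule writes `true` into this cell and yet changes nothing, so the cell contains `true`
    -- already, provided that it lies on the tape.
    · have h' := congrFun (congrArg Prod.fst h) (some ρ.head.1)
      simp only [Function.update_self] at h'
      rw [← h', List.getElem?_set_self]
      rw [hlen, ← hd.1]
      exact Nat.ofDigits_lt_base_pow_length (by unfold base; omega) hd.2
    · rw [List.all_eq_true]
      intro l hl
      simp only [HornRule.lits, List.mem_append, List.mem_map] at hl
      rcases hl with ⟨l, hl, rfl⟩ | ⟨l, hl, rfl⟩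
      · simpa [holdsLit, hw] using hi l hl
      · simpa [holdsLit] using ih l hl

variable [DecidableEq V] [Fintype V] [Fintype T]

/-- The program that decides whether the fact `goal` cannot be derived. -/
noncomputable def prog (D : HornProgram V T) (goal : T) :
    StackProg (Reg V T D.maxArity × Bool) :=
  seq (initProg D.maxArity D.maxConst D.arity)
  (seq (saturateProg D.maxArity Finset.univ.toList D.rules)
  (seq (load fun v => { v with ok := true })
  (seq (testTape (List.finRange D.maxArity) (some goal) [] true)
  (seq (clearAll Finset.univ.toList)
  (seq (push (.out, false) fun v => !v.ok) (load fun _ => ⟨none, false, false⟩))))))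

open Classical in
/-- Whether a fact without arguments can be derived by a Horn program is decidable in polynomial
time. -/
theorem computableInPolyTime (D : HornProgram V T) (goal : T) (hgoal : D.arity goal = 0)
    {α : Type} (enc : α → List Bool) :
    Nonempty (TM2ComputableInPolyTime enc Computability.encodeBool
      fun x => decide (¬ D.Derives (enc x) goal [])) := by
  set J := D.maxArity with hJ
  have hnd : (Finset.univ.toList : List V).Nodup := Finset.nodup_toList _
  obtain ⟨p₁, h₁⟩ := within_initProg (V := V) (J := J) D.maxConst D.arity D.arity_le_maxArity
  obtain ⟨p₂, h₂⟩ := within_saturateProg (J := J) (Finset.univ.toList : List V) hnd D.rules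
    (fun ρ hρ => D.lits_length_le ρ hρ)
    (fun ρ hρ => (D.head_arity ρ hρ).le.trans (D.arity_le_maxArity _))
  obtain ⟨p₃, h₃⟩ := within_testTape (V := V) (List.finRange J) (List.nodup_finRange J)
    (some goal) [] true (by simp)
  -- The value of `N` is `base ^ J`, which bounds the lengths of all tapes, and also the base itself
  -- because `J` is positive. The parts of the program run in time polynomial in this number.
  set N : Polynomial ℕ := (Polynomial.X + ((D.maxConst + 2 : ℕ) : Polynomial ℕ)) ^ J with hN
  refine computableInPolyTime_of_within (D.prog goal) (.tape none, false) (.out, false)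
    (fun w => decide (¬ D.Derives w goal []))
    (p₁ + (p₂.comp N + (1 + (p₃.comp N + (((Fintype.card (Reg V T J × Bool) : Polynomial ℕ) * (2 * N + 1) + 1) + (1 + 1))))))
    (fun w => ?_) enc
  set n := N.eval w.length with hn
  have hn' : n = D.base w ^ J := by simp [hn, hN, base, add_assoc]
  have hbase : 1 ≤ D.base w := by unfold base; omega
  have hCn : D.base w ≤ n := by
    rw [hn']; exact Nat.le_self_pow (by rw [hJ, maxArity]; omega) _
  have hlen₀ : ∀ t, (initialTapes (D.base w) D.arity w t).length ≤ n := by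
    rintro (_ | t)
    · exact le_trans (by simp [initialTapes, base]; omega) hCn
    · simpa [initialTapes, hn'] using Nat.pow_le_pow_right hbase (D.arity_le_maxArity t)
  obtain ⟨g, hsound, hlen, hclosed, hsat⟩ := h₂ n (w.length + 1) (D.base w) (fun _ => 0)
    (fun _ => w.length + 1) (initialTapes (D.base w) D.arity w) (D.SoundTapes w) hCn
    (le_trans (by unfold base; omega) hCn) (fun _ => Nat.zero_le _) hlen₀ (fun _ _ => ⟨rfl, rfl⟩)
    ⟨rfl, fun t i hi => by
      have := List.eq_of_mem_replicate (List.mem_of_getElem? hi)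
      simp at this⟩
    (by
      intro x s hs hx
      simp only [sweepSteps, List.mem_flatMap, List.mem_map] at hs
      obtain ⟨ρ, hρ, ν, hν, rfl⟩ := hs
      exact hx.applyRule hρ fun v =>
        Nat.lt_succ_iff.1 ((lt_of_mem_valuations hν v).1 (by simp)))
  have hg : (g (some goal))[0]? = some true ↔ D.Derives w goal [] := by
    constructor
    · intro h
      obtain ⟨ys, hys, -⟩ := hsound.2 goal 0 h
      have := hys.wf.1
      rw [hgoal, List.length_eq_zero_iff] at this
      exact this ▸ hys
    · intro h
      have := h.mem_tapes hsound.1 (fun t => (hlen (some t)).trans (by simp [initialTapes]))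
        fun ρ hρ ν hν => hclosed (ρ, ν) (by
          simp only [sweepSteps, List.mem_flatMap, List.mem_map]
          exact ⟨ρ, hρ, ν, mem_valuations (fun v _ => Nat.lt_succ_iff.2 (hν v)) (by simp), rfl⟩)
      simpa using this
  have k₄ := h₃ n (D.base w) (fun _ => 0)
    (layout (D.base w) (fun _ => 0) (fun _ => w.length + 1) g) { mem false with ok := true } hCn
    (fun _ => Nat.zero_le _) rfl (countersOK_layout ..) ((hlen _).le.trans (hlen₀ _)) rfl
  -- A halting configuration has the initial memory and no stack contents besides the output, hence
  -- the cleaning.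
  have k₅ := within_clearAll (Finset.univ.toList : List (Reg V T J × Bool)) n
    { mem false with ok := true && ((g (some goal))[0]? == some true) } rfl
    (layout (D.base w) (fun _ => 0) (fun _ => w.length + 1) g) (by
      rintro ⟨r, b⟩
      cases r <;> cases b <;> simp only [layout, List.length_replicate, List.length_nil, zero_le]
      · exact le_trans (by unfold base; omega) hCn
      · exact hCn
      · exact (hlen _).le.trans (hlen₀ _))
  refine (Within.seq (h₁ w) (Within.seq hsat (Within.seq (within_load _ _ _) (Within.seq k₄
    (Within.seq k₅ (Within.seq (within_push _ _ _ _) (within_load _ _ _))))))).cast rfl ?_ ?_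
  · simp only [Finset.mem_toList, Finset.mem_univ, if_true]
    congr 2
    by_cases h : D.Derives w goal []
    · simp [h, hg.2 h]
    · have := mt hg.1 h
      simp [h, this]
  · simp [Polynomial.eval_comp, ← hn]

end HornProgram

/-! ### The lexicographic order on reversed words -/

section ColexOrder

variable {α : Type*} [LinearOrder α]

theorem append_lt_append_left_iff {x l m : List α} : x ++ l < x ++ m ↔ l < m := by
  induction x with
  | nil => rfl
  | cons a x ih => simp [ih]

/-- Appending to a word that is no prefix of a larger word keeps it smaller. -/
theorem append_lt_of_not_prefix {l m : List α} (h : l < m) (h' : ¬ l <+: m) (y : List α) :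
    l ++ y < m := by
  induction l generalizing m with
  | nil => simp at h'
  | cons a l ih =>
    obtain _ | ⟨b, m⟩ := m
    · simp at h
    rw [List.cons_append, List.cons_lt_cons_iff]
    rcases List.cons_lt_cons_iff.1 h with h₁ | ⟨rfl, h₁⟩
    · exact Or.inl h₁
    · exact Or.inr ⟨rfl, ih h₁ fun hp => h' (by simpa using hp)⟩

/-- The words with a given prefix are convex in the lexicographic order. -/
theorem prefix_of_between {x a b c : List α} (ha : x <+: a) (hc : x <+: c) (hab : a < b)
    (hbc : b < c) : x <+: b := by
  induction x generalizing a b c with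
  | nil => simp
  | cons d x ih =>
    obtain ⟨a, rfl⟩ := ha
    obtain ⟨c, rfl⟩ := hc
    obtain _ | ⟨e, b⟩ := b
    · simp at hab
    simp only [List.cons_append, List.cons_lt_cons_iff] at hab hbc
    rcases hab with h | ⟨rfl, h⟩
    · rcases hbc with h' | ⟨rfl, h'⟩
      · exact absurd (h.trans h') (lt_irrefl _)
      · exact absurd h (lt_irrefl _)
    · rcases hbc with h' | ⟨-, h'⟩
      · exact absurd h' (lt_irrefl _)
      · simpa using ih (List.prefix_append x a) (List.prefix_append x c) h h'

end ColexOrder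

section Residual

variable {α : Type} [LinearOrder α]

/-- The words that continue the reversal of `r` to a word of the language. -/
def continuations (L : Language α) (r : List α) : Set (List α) := {z | r.reverse ++ z ∈ L}

omit [LinearOrder α] in
theorem continuations_cons (L : Language α) (a : α) (r : List α) :
    continuations L (a :: r) = {z | a :: z ∈ continuations L r} := by
  ext z; simp [continuations]

end Residual

/-! ### Necessary condition: no infinite alternation -/

section WheelerNecessary

variable {α Q : Type} [LinearOrder α] [LinearOrder Q] {M : NFA α Q} {s : Q}

/-- In a Wheeler automaton, the sets of states reached by words are monotone. -/
theorem IsWheelerNFA.mem_eval_of_lt (hW : IsWheelerNFA M s) {r r' : List α} (h : r < r') {p q : Q}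
    (hp : p ∈ M.eval r.reverse) (hq : q ∈ M.eval r'.reverse) (hqp : q < p) :
    p ∈ M.eval r'.reverse ∧ q ∈ M.eval r.reverse := by
  induction r' generalizing r p q with
  | nil => simp at h
  | cons b r' ih =>
    obtain _ | ⟨a, r⟩ := r
    · rw [List.reverse_nil, NFA.eval_nil, hW.start_eq, Set.mem_singleton_iff] at hp
      subst hp
      exact absurd hqp (hW.start_le q).not_gt
    rw [List.reverse_cons, NFA.eval_append_singleton, NFA.mem_stepSet] at hp hq
    obtain ⟨p', hp', hp⟩ := hp
    obtain ⟨q', hq', hq⟩ := hq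
    rcases List.cons_lt_cons_iff.1 h with h₁ | ⟨rfl, h₁⟩
    · exact absurd hqp (hW.lt_of_letter_lt _ _ _ _ _ _ hp hq h₁).not_gt
    -- The words end with the same letter. If `p' < q'`, the second Wheeler property gives `p ≤ q`,
    -- a contradiction; otherwise `p'` and `q'` belong to both sets, trivially or by induction, and
    -- one step carries this over to `p` and `q`.
    · have key : p' ∈ M.eval r'.reverse ∧ q' ∈ M.eval r.reverse := by
        rcases lt_trichotomy p' q' with h' | rfl | h'
        · exact absurd hqp (hW.le_of_source_lt _ _ _ _ _ _ hp hq ⟨rfl, h'⟩).not_gt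
        · exact ⟨hq', hp'⟩
        · exact ih h₁ hp' hq' h'
      simp only [List.reverse_cons, NFA.eval_append_singleton, NFA.mem_stepSet]
      exact ⟨⟨p', key.1, hp⟩, ⟨q', key.2, hq⟩⟩

/-- For `p` reached by `r₁`, hence also by `r₃`, and `q` reached by `r₂`, monotonicity applies to
`r₁ < r₂` if `q < p`, and to `r₂ < r₃` if `p < q`. Either way both states are reached by both words;
as the sets are nonempty, they are equal. -/
theorem IsWheelerNFA.eval_eq_of_between (hW : IsWheelerNFA M s) {r₁ r₂ r₃ : List α} (h₁₂ : r₁ < r₂)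
    (h₂₃ : r₂ < r₃) (he : M.eval r₁.reverse = M.eval r₃.reverse) (h₁ : (M.eval r₁.reverse).Nonempty)
    (h₂ : (M.eval r₂.reverse).Nonempty) : M.eval r₂.reverse = M.eval r₁.reverse := by
  have key : ∀ p ∈ M.eval r₁.reverse, ∀ q ∈ M.eval r₂.reverse,
      p ∈ M.eval r₂.reverse ∧ q ∈ M.eval r₁.reverse := by
    intro p hp q hq
    rcases lt_trichotomy p q with h | rfl | h
    · rw [he] at hp ⊢
      exact (hW.mem_eval_of_lt h₂₃ hq hp h).symm
    · exact ⟨hq, hp⟩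
    · exact hW.mem_eval_of_lt h₁₂ hp hq h
  obtain ⟨p₀, hp₀⟩ := h₁
  obtain ⟨q₀, hq₀⟩ := h₂
  exact Set.Subset.antisymm (fun q hq => (key p₀ hp₀ q hq).2) fun p hp => (key p hp q₀ hq₀).1

-- The continuations depend only on the set of states reached, so equal sets of states force equal
-- continuations.
omit [LinearOrder α] [LinearOrder Q] in
theorem continuations_accepts (M : NFA α Q) (r : List α) :
    continuations M.accepts r = {z | ∃ f ∈ M.accept, f ∈ M.evalFrom (M.eval r.reverse) z} := by
  ext z
  simp [continuations, NFA.mem_accepts, NFA.evalFrom_append, NFA.eval]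

/-- In a Wheeler language, no two sets of continuations alternate infinitely often along a monotone sequence. -/
theorem not_isWheelerLanguage_of_alternating {L : Language α} (x y : ℕ → List α)
    (h : (∀ j k, j < k → x j < y k ∧ y j < x k) ∨ (∀ j k, j < k → x k < y j ∧ y k < x j))
    (R R' : Set (List α)) (hx : ∀ k, continuations L (x k) = R) (hy : ∀ k, continuations L (y k) = R')
    (hne : R ≠ R') (hR : R.Nonempty) (hR' : R'.Nonempty) : ¬ IsWheelerLanguage L := by
  rintro ⟨Q, _, _, M, s, hW, rfl⟩
  have nonempty : ∀ r, (continuations M.accepts r).Nonempty → (M.eval r.reverse).Nonempty := by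
    rintro r ⟨z, hz⟩
    rw [continuations_accepts] at hz
    by_contra hn
    rw [Set.not_nonempty_iff_eq_empty] at hn
    obtain ⟨f, -, hf⟩ := hz
    rw [hn, NFA.mem_evalFrom_iff_exists] at hf
    simp at hf
  -- Even indices leave room for `y (2 * i + 1)` strictly between `x (2 * i)` and `x (2 * j)`, which
  -- reach the same set of states.
  obtain ⟨i, j, hij, he⟩ :=
    Finite.exists_ne_map_eq_of_infinite fun k : ℕ => M.eval (x (2 * k)).reverse
  wlog hlt : i < j generalizing i j
  · exact this j i hij.symm he.symm (by omega)
  apply hne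
  rw [← hx (2 * i), ← hy (2 * i + 1), continuations_accepts, continuations_accepts]
  have hxn : ∀ k, (M.eval (x k).reverse).Nonempty := fun k => nonempty _ (by rw [hx]; exact hR)
  have hyn : ∀ k, (M.eval (y k).reverse).Nonempty := fun k => nonempty _ (by rw [hy]; exact hR')
  have : M.eval (y (2 * i + 1)).reverse = M.eval (x (2 * i)).reverse := by
    rcases h with h | h
    · exact hW.eval_eq_of_between (h _ _ (by omega)).1 (h (2 * i + 1) (2 * j) (by omega)).2 he
        (hxn _) (hyn _)
    · rw [he]
      exact hW.eval_eq_of_between (h (2 * i + 1) (2 * j) (by omega)).1 (h _ _ (by omega)).2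
        he.symm (hxn _) (hyn _)
  rw [this]

end WheelerNecessary

/-! ### Sufficient condition: convexity of the classes of prefixes -/

section WheelerSufficient

variable {α : Type} [LinearOrder α] (L : Language α) (N : ℕ)

/-- The prefixes of the words of a language, reversed. -/
def Live : Type := {r : List α // (continuations L r).Nonempty}

/-- The class of a prefix: its last `N` letters and its continuations. -/
def Live.cls {L : Language α} (w : Live L) : List α × Set (List α) :=
  (w.1.take N, continuations L w.1)

/-- The set of all classes. -/
def LiveClass : Type := {x : List α × Set (List α) // ∃ w : Live L, w.cls N = x}

variable {L N}

/-- A word with fewer than `N` letters is determined by its class, which is impossible for `w₁ <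
w₃`. So `w₁` and `w₃` share a full block of `N` letters; the word between them has the same block,
and `hconv` applies. -/
theorem Live.cls_eq_of_between
    (hconv : ∀ r₁ r₂ r₃ : List α, (continuations L r₁).Nonempty → (continuations L r₂).Nonempty →
      r₁ < r₂ → r₂ < r₃ → (∃ x, x.length = N ∧ x <+: r₁ ∧ x <+: r₂ ∧ x <+: r₃) →
      continuations L r₁ = continuations L r₃ → continuations L r₂ = continuations L r₁) {w₁ w₂ w₃ : Live L}
    (h₁₂ : w₁.1 < w₂.1) (h₂₃ : w₂.1 < w₃.1) (h : w₁.cls N = w₃.cls N) : w₂.cls N = w₁.cls N := by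
  obtain ⟨ht, hr⟩ := Prod.ext_iff.1 h
  simp only [Live.cls] at ht hr
  have hlen : (w₁.1.take N).length = N := by
    by_contra hne
    have h1 : w₁.1.length < N := by rw [List.length_take] at hne; omega
    have h3 : w₃.1.length < N := by rw [ht, List.length_take] at hne; omega
    rw [List.take_of_length_le h1.le, List.take_of_length_le h3.le] at ht
    exact absurd (h₁₂.trans h₂₃) (by rw [ht]; exact lt_irrefl _)
  have p₁ : w₁.1.take N <+: w₁.1 := List.take_prefix _ _
  have p₃ : w₁.1.take N <+: w₃.1 := ht ▸ List.take_prefix _ _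
  have p₂ := prefix_of_between p₁ p₃ h₁₂ h₂₃
  refine Prod.ext ?_ (hconv _ _ _ w₁.2 w₂.2 h₁₂ h₂₃ ⟨_, hlen, p₁, p₂, p₃⟩ hr)
  simp only [Live.cls]
  rw [List.prefix_iff_eq_take, hlen] at p₂
  exact p₂.symm

/-- A language is Wheeler if it has finitely many sets of continuations and, among the prefixes that end with
the same `N` letters, those with the same continuations are convex. -/
theorem isWheelerLanguage_of_convex [Finite α] (hN : 1 ≤ N)
    (hfin : (Set.range (continuations L)).Finite)
    (hconv : ∀ r₁ r₂ r₃ : List α, (continuations L r₁).Nonempty → (continuations L r₂).Nonempty →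
      r₁ < r₂ → r₂ < r₃ → (∃ x, x.length = N ∧ x <+: r₁ ∧ x <+: r₂ ∧ x <+: r₃) →
      continuations L r₁ = continuations L r₃ → continuations L r₂ = continuations L r₁) : IsWheelerLanguage L := by
  by_cases hL : (continuations L []).Nonempty
  swap
  -- If the empty word has no continuation, the language is empty.
  · refine ⟨Unit, inferInstance, inferInstance, ⟨fun _ _ => ∅, {()}, ∅⟩, (), ?_, ?_⟩
    · constructor <;> simp
    · ext z
      simp only [NFA.mem_accepts]
      refine ⟨fun ⟨_, h, _⟩ => h.elim, fun hz => (hL ⟨z, by simpa [continuations] using hz⟩).elim⟩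
  set c : Live L → LiveClass L N := fun w => ⟨w.cls N, w, rfl⟩ with hc
  have hceq : ∀ {w w' : Live L}, c w = c w' ↔ w.cls N = w'.cls N := Subtype.ext_iff
  -- Classes are ordered by arbitrary representatives. Convexity makes the choice immaterial: the
  -- map from prefixes to classes is monotone (`hmono`).
  choose out hout using fun q : LiveClass L N => q.2
  have hcout : ∀ q, c (out q) = q := fun q => Subtype.ext (hout q)
  have hinj : Function.Injective fun q => (out q).1 := fun q q' h => by
    rw [← hcout q, ← hcout q', Subtype.ext h]
  let _ : LinearOrder (LiveClass L N) := LinearOrder.lift' _ hinj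
  have hfinQ : Finite (LiveClass L N) := by
    refine Set.Finite.subset (t := {x | ∃ w : Live L, w.cls N = x}) ((List.finite_length_le α N).prod hfin) ?_
    rintro _ ⟨w, rfl⟩
    exact ⟨by simp [Live.cls], w.1, rfl⟩
  have hmono : ∀ {w w' : Live L}, w.1 < w'.1 → c w ≤ c w' := by
    intro w w' h
    by_contra hn
    rw [not_le] at hn
    have ho : (out (c w')).1 < (out (c w)).1 := hn
    have e := hceq.1 (hcout (c w))
    have e' := hceq.1 (hcout (c w'))
    rcases lt_trichotomy w.1 (out (c w')).1 with h' | h' | h'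
    · have := Live.cls_eq_of_between hconv h' ho e.symm
      exact hn.ne (hceq.2 (e'.symm.trans this))
    · have : w = out (c w') := Subtype.ext h'
      exact hn.ne (hceq.2 (e'.symm.trans (by rw [← this])))
    · have := Live.cls_eq_of_between hconv h' h e'
      exact hn.ne (hceq.2 (e'.symm.trans this.symm))
  have hlt : ∀ {w w' : Live L}, c w < c w' → w.1 < w'.1 := by
    intro w w' h
    rcases lt_trichotomy w.1 w'.1 with h' | h' | h'
    · exact h'
    · rw [show w = w' from Subtype.ext h'] at h; exact absurd h (lt_irrefl _)
    · exact absurd (hmono h') h.not_ge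
  set M : NFA α (LiveClass L N) :=
    ⟨fun q a => {q' | ∃ w w' : Live L, w'.1 = a :: w.1 ∧ c w = q ∧ c w' = q'}, {c ⟨[], hL⟩},
      {q | [] ∈ q.1.2}⟩ with hM
  -- The automaton is deterministic in effect: a prefix of a word of the language leads to its own
  -- class only, any other word leads nowhere. Class and next letter determine the next class.
  have heval : ∀ r : List α, M.eval r.reverse = {q | ∃ w : Live L, w.1 = r ∧ c w = q} := by
    intro r
    induction r with
    | nil =>
      ext q
      simp only [List.reverse_nil, NFA.eval_nil, Set.mem_ofPred_eq]
      constructor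
      · intro h; exact ⟨⟨[], hL⟩, rfl, h.symm⟩
      · rintro ⟨⟨_, h⟩, rfl, rfl⟩; rfl
    | cons a r ih =>
      ext q
      rw [List.reverse_cons, NFA.eval_append_singleton, NFA.mem_stepSet, ih]
      constructor
      · rintro ⟨_, ⟨w₀, rfl, rfl⟩, w, w', hw, he, rfl⟩
        rw [hceq] at he
        obtain ⟨ht, hr⟩ := Prod.ext_iff.1 he
        simp only [Live.cls] at ht hr
        have hr' : continuations L (a :: w₀.1) = continuations L w'.1 := by
          rw [hw, continuations_cons, continuations_cons, hr]
        refine ⟨⟨a :: w₀.1, hr' ▸ w'.2⟩, rfl, hceq.2 (Prod.ext ?_ hr')⟩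
        obtain ⟨N, rfl⟩ : ∃ k, N = k + 1 := ⟨N - 1, by omega⟩
        have : w₀.1.take N = w.1.take N := by
          have := congrArg (List.take N) ht
          simpa [List.take_take] using this.symm
        simp [Live.cls, hw, this]
      · rintro ⟨w', hw', rfl⟩
        obtain ⟨z, hz⟩ := w'.2
        rw [hw', continuations_cons] at hz
        exact ⟨_, ⟨⟨r, _, hz⟩, rfl, rfl⟩, ⟨r, _, hz⟩, w', hw', rfl, rfl⟩
  refine ⟨_, hfinQ, inferInstance, M, c ⟨[], hL⟩, ?_, ?_⟩
  · refine ⟨rfl, fun q => ?_, ?_, ?_, ?_⟩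
    · have key : ∀ w : Live L, c ⟨[], hL⟩ ≤ c w := by
        rintro ⟨_ | ⟨a, r⟩, hr⟩
        · exact le_rfl
        · exact hmono (List.nil_lt_cons a r)
      exact hcout q ▸ key (out q)
    -- As `N` is positive, the class shows the last letter read. So no edge enters the class of the
    -- empty word, and below, different last letters give different classes.
    · rintro u a ⟨w, w', hw, -, h⟩
      obtain ⟨ht, -⟩ := Prod.ext_iff.1 (hceq.1 h)
      obtain ⟨N, rfl⟩ : ∃ k, N = k + 1 := ⟨N - 1, by omega⟩
      simp [Live.cls, hw] at ht
    · rintro u₁ u₂ v₁ v₂ a₁ a₂ ⟨w₁, w₁', h₁, rfl, rfl⟩ ⟨w₂, w₂', h₂, rfl, rfl⟩ ha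
      refine lt_of_le_of_ne (hmono ?_) fun h => ?_
      · rw [h₁, h₂, List.cons_lt_cons_iff]; exact Or.inl ha
      · obtain ⟨ht, -⟩ := Prod.ext_iff.1 (hceq.1 h)
        obtain ⟨N, rfl⟩ : ∃ k, N = k + 1 := ⟨N - 1, by omega⟩
        simp [Live.cls, h₁, h₂, ha.ne] at ht
    · rintro u₁ u₂ v₁ v₂ a₁ a₂ ⟨w₁, w₁', h₁, rfl, rfl⟩ ⟨w₂, w₂', h₂, rfl, rfl⟩ ⟨rfl, hu⟩
      refine hmono ?_
      rw [h₁, h₂, List.cons_lt_cons_iff]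
      exact Or.inr ⟨rfl, hlt hu⟩
  · ext z
    have := heval z.reverse
    rw [List.reverse_reverse] at this
    change (∃ q ∈ M.accept, q ∈ M.eval z) ↔ _
    rw [this]
    constructor
    · rintro ⟨_, hq, w, hw, rfl⟩
      have : [] ∈ continuations L w.1 := hq
      simpa [continuations, hw] using this
    · intro hz
      have : [] ∈ continuations L z.reverse := by simpa [continuations] using hz
      exact ⟨c ⟨z.reverse, _, this⟩, this, _, rfl, rfl⟩

end WheelerSufficient

/-! ### The forbidden pattern in a deterministic automaton -/

theorem lt_append_of_lt {α : Type*} [LinearOrder α] {l m : List α} (h : l < m) (y : List α) :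
    l < m ++ y := by
  induction m generalizing l with
  | nil => simp at h
  | cons b m ih =>
    obtain _ | ⟨a, l⟩ := l
    · exact List.nil_lt_cons _ _
    rw [List.cons_append, List.cons_lt_cons_iff]
    rcases List.cons_lt_cons_iff.1 h with h₁ | ⟨rfl, h₁⟩
    · exact Or.inl h₁
    · exact Or.inr ⟨rfl, ih h₁⟩

/-- `Diverges s μ γ`: in the lexicographic order, `μ` is smaller than `γ` (if `s` is false), or `μ`
is larger than all words with the prefix `γ` (if `s` is true). -/
def Diverges {α : Type*} [LinearOrder α] (s : Bool) (μ γ : List α) : Prop :=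
  if s then γ < μ ∧ ¬ γ <+: μ else μ < γ

namespace EdgeDFA

variable (A : EdgeDFA)

/-- The state reached from `q` by reading the reversal of a word, if there is one. -/
def back (A : EdgeDFA) (q : Fin A.numStates) :
    List (Fin A.numLetters) → Option (Fin A.numStates)
  | [] => some q
  | a :: r => (back A q r).bind fun p => A.step p a

/-- The automaton accepts the word `z` from the state `q`. -/
def Accepts (q : Fin A.numStates) (z : List (Fin A.numLetters)) : Prop :=
  ∃ f, A.run q z = some f ∧ A.accept f = true

theorem run_append (q : Fin A.numStates) (x y : List (Fin A.numLetters)) :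
    A.run q (x ++ y) = (A.run q x).bind fun p => A.run p y := by
  induction x generalizing q with
  | nil => simp [run]
  | cons a x ih =>
    simp only [List.cons_append, run, Option.bind_assoc]
    congr 1
    funext p
    exact ih p

theorem run_reverse (q : Fin A.numStates) (r : List (Fin A.numLetters)) :
    A.run q r.reverse = A.back q r := by
  induction r with
  | nil => rfl
  | cons a r ih => simp [run_append, ih, back, run]

theorem back_append (q : Fin A.numStates) (x y : List (Fin A.numLetters)) :
    A.back q (x ++ y) = (A.back q y).bind fun p => A.back p x := by
  simp only [← run_reverse, List.reverse_append, run_append]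

variable {A}

theorem accepts_reverse_append {q p : Fin A.numStates} {r z : List (Fin A.numLetters)}
    (h : A.back q r = some p) : A.Accepts q (r.reverse ++ z) ↔ A.Accepts p z := by
  simp [Accepts, run_append, run_reverse, h]

theorem continuations_language {r : List (Fin A.numLetters)} {q : Fin A.numStates}
    (h : A.back A.start r = some q) : continuations A.language r = {z | A.Accepts q z} := by
  ext z
  exact accepts_reverse_append h

theorem exists_back_of_continuations {r : List (Fin A.numLetters)}
    (h : (continuations A.language r).Nonempty) : ∃ q, A.back A.start r = some q := by
  obtain ⟨z, f, hf, -⟩ := h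
  rw [run_append, run_reverse] at hf
  rcases hq : A.back A.start r with _ | q
  · simp [hq] at hf
  · exact ⟨q, rfl⟩

variable (A)

/-- Two inequivalent states with equally labelled cycles that can be reached by two words on the same
side of the label of the cycle. All words are reversed. -/
def HasPattern : Prop :=
  ∃ (s : Bool) (u v : Fin A.numStates) (γ μ ν : List (Fin A.numLetters)),
    A.back u γ = some u ∧ A.back v γ = some v ∧ A.back A.start μ = some u ∧
    A.back A.start ν = some v ∧ Diverges s μ γ ∧ Diverges s ν γ ∧
    (∃ z, A.Accepts u z ∧ ¬ A.Accepts v z) ∧ ∃ z, A.Accepts v z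

variable {A}

theorem back_flatten_replicate {u : Fin A.numStates} {γ : List (Fin A.numLetters)}
    (h : A.back u γ = some u) (k : ℕ) : A.back u (List.replicate k γ).flatten = some u := by
  induction k with
  | zero => rfl
  | succ k ih => rw [List.replicate_succ', List.flatten_append, back_append]; simp [h, ih]

/-- The alternating sequences are `γ ^ k ++ μ` and `γ ^ k ++ ν`. For `j < k`, cancelling `γ ^ j`
leaves the comparison of `μ` or `ν` with a word that begins with `γ`, and `Diverges` settles this
whatever follows. -/
theorem HasPattern.not_isWheelerLanguage (h : A.HasPattern) : ¬ IsWheelerLanguage A.language := by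
  obtain ⟨s, u, v, γ, μ, ν, hu, hv, hμ, hν, hμγ, hνγ, ⟨z, hz, hz'⟩, z', hz''⟩ := h
  have key : ∀ (μ ν : List (Fin A.numLetters)), Diverges s μ γ → ∀ j k, j < k →
      if s then (List.replicate k γ).flatten ++ ν < (List.replicate j γ).flatten ++ μ
      else (List.replicate j γ).flatten ++ μ < (List.replicate k γ).flatten ++ ν := by
    intro μ ν h j k hjk
    obtain ⟨d, rfl⟩ : ∃ d, k = j + (d + 1) := ⟨k - j - 1, by omega⟩
    rw [List.replicate_add, List.flatten_append, List.replicate_succ, List.flatten_cons,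
      List.append_assoc, append_lt_append_left_iff, append_lt_append_left_iff, List.append_assoc]
    cases s
    · simpa using lt_append_of_lt h _
    · simpa using append_lt_of_not_prefix h.1 h.2 _
  have hx : ∀ k, A.back A.start ((List.replicate k γ).flatten ++ μ) = some u := fun k => by
    rw [back_append, hμ]; exact back_flatten_replicate hu k
  have hy : ∀ k, A.back A.start ((List.replicate k γ).flatten ++ ν) = some v := fun k => by
    rw [back_append, hν]; exact back_flatten_replicate hv k
  refine not_isWheelerLanguage_of_alternating (fun k => (List.replicate k γ).flatten ++ μ)
    (fun k => (List.replicate k γ).flatten ++ ν) ?_ {z | A.Accepts u z} {z | A.Accepts v z}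
    (fun k => continuations_language (hx k)) (fun k => continuations_language (hy k))
    (fun he => hz' (by have : z ∈ {z | A.Accepts u z} := hz; rwa [he] at this))
    ⟨z, hz⟩ ⟨z', hz''⟩
  cases s
  · exact Or.inl fun j k hjk => ⟨by simpa using key μ ν hμγ j k hjk,
      by simpa using key ν μ hνγ j k hjk⟩
  · exact Or.inr fun j k hjk => ⟨by simpa using key ν μ hνγ j k hjk,
      by simpa using key μ ν hμγ j k hjk⟩

/-- The pattern asks for a word accepted from `u` but not from `v`. All other conditions are
symmetric, so the two states may be exchanged. -/
theorem hasPattern_of_ne {s : Bool} {u v : Fin A.numStates} {γ μ ν : List (Fin A.numLetters)}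
    (hu : A.back u γ = some u) (hv : A.back v γ = some v) (hμ : A.back A.start μ = some u)
    (hν : A.back A.start ν = some v) (hμγ : Diverges s μ γ) (hνγ : Diverges s ν γ)
    (hu' : ∃ z, A.Accepts u z) (hv' : ∃ z, A.Accepts v z)
    (hne : {z | A.Accepts u z} ≠ {z | A.Accepts v z}) : A.HasPattern := by
  rw [Ne, Set.ext_iff, not_forall] at hne
  obtain ⟨z, hz⟩ := hne
  by_cases h : A.Accepts u z
  · exact ⟨s, u, v, γ, μ, ν, hu, hv, hμ, hν, hμγ, hνγ, ⟨z, h, fun h' => hz (iff_of_true h h')⟩, hv'⟩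
  · exact ⟨s, v, u, γ, ν, μ, hv, hu, hν, hμ, hνγ, hμγ,
      ⟨z, by_contra fun h' => hz (iff_of_false h h'), h⟩, hu'⟩

/-- Three prefixes in increasing order, the second one inequivalent to the others, give a pattern if
they share a suffix that labels three cycles. -/
theorem hasPattern_of_cycles {a γ y₁ y₂ y₃ : List (Fin A.numLetters)} {p₁ p₂ p₃ : Fin A.numStates}
    (hγ : γ ≠ []) (h₁₂ : y₁ < y₂) (h₂₃ : y₂ < y₃) (hy₁ : A.back A.start y₁ = some p₁)
    (hy₂ : A.back A.start y₂ = some p₂) (hy₃ : A.back A.start y₃ = some p₃)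
    (hp₁ : A.back p₁ γ = some p₁) (hp₂ : A.back p₂ γ = some p₂) (hp₃ : A.back p₃ γ = some p₃)
    (hL₁ : (continuations A.language (a ++ y₁)).Nonempty)
    (hL₂ : (continuations A.language (a ++ y₂)).Nonempty)
    (he : continuations A.language (a ++ y₁) = continuations A.language (a ++ y₃))
    (hne : continuations A.language (a ++ y₂) ≠ continuations A.language (a ++ y₁)) :
    A.HasPattern := by
  have mem : ∀ {y : List (Fin A.numLetters)} {p}, A.back A.start y = some p → ∀ z,
      (z ∈ continuations A.language (a ++ y) ↔ A.Accepts p (a.reverse ++ z)) := by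
    intro y p hp z
    rw [← accepts_reverse_append hp, ← List.append_assoc, ← List.reverse_append]
    rfl
  have live : ∀ {y : List (Fin A.numLetters)} {p}, A.back A.start y = some p →
      (continuations A.language (a ++ y)).Nonempty → ∃ z, A.Accepts p z :=
    fun hp ⟨z, hz⟩ => ⟨_, (mem hp z).1 hz⟩
  have ne : ∀ {y y' : List (Fin A.numLetters)} {p p'}, A.back A.start y = some p →
      A.back A.start y' = some p' → continuations A.language (a ++ y) ≠
      continuations A.language (a ++ y') → {z | A.Accepts p z} ≠ {z | A.Accepts p' z} := by
    intro y y' p p' hp hp' hne h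
    refine hne (Set.ext fun z => ?_)
    rw [mem hp, mem hp']
    exact Set.ext_iff.1 h _
  -- The power `g` of `γ` is longer than all three words and so a prefix of none. If `y₂ < g`, then
  -- `y₁` and `y₂` lie below `g`; if `g < y₂`, then `y₂` and `y₃` lie above it. Both pairs are
  -- inequivalent.
  set k := y₁.length + y₂.length + y₃.length + 1 with hk
  set g := (List.replicate k γ).flatten with hg
  have hlen : k ≤ g.length := by
    have := List.length_pos_iff.2 hγ
    rw [hg]; simp; nlinarith
  have npre : ∀ y : List (Fin A.numLetters), y.length < k → ¬ g <+: y := fun y hy hp => by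
    have := hp.length_le; omega
  rcases lt_trichotomy y₂ g with h | h | h
  · exact hasPattern_of_ne (s := false) (back_flatten_replicate hp₁ k) (back_flatten_replicate hp₂ k)
      hy₁ hy₂ (h₁₂.trans h) h (live hy₁ hL₁) (live hy₂ hL₂) (ne hy₁ hy₂ hne.symm)
  · exact absurd (h ▸ List.prefix_refl _) (npre y₂ (by omega))
  · exact hasPattern_of_ne (s := true) (back_flatten_replicate hp₂ k) (back_flatten_replicate hp₃ k)
      hy₂ hy₃ ⟨h, npre _ (by omega)⟩ ⟨h.trans h₂₃, npre _ (by omega)⟩ (live hy₂ hL₂)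
      (live hy₃ (he ▸ hL₁)) (ne hy₂ hy₃ (he ▸ hne))

/-- A violation of convexity consists of three prefixes with a common suffix of `numStates ^ 3`
letters. Reading this suffix passes through more triples of states than are distinct, so some piece
of it labels cycles in all three runs. -/
theorem isWheelerLanguage_of_not_hasPattern (h : ¬ A.HasPattern) :
    IsWheelerLanguage A.language := by
  have hn : 1 ≤ A.numStates := Nat.one_le_iff_ne_zero.2 fun h0 => (h0 ▸ A.start).elim0
  refine isWheelerLanguage_of_convex (N := A.numStates ^ 3) (Nat.one_le_pow _ _ hn) ?_ ?_
  · refine ((Set.finite_range fun q : Fin A.numStates => {z | A.Accepts q z}).insert ∅).subset ?_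
    rintro _ ⟨r, rfl⟩
    by_cases hr : (continuations A.language r).Nonempty
    · obtain ⟨q, hq⟩ := exists_back_of_continuations hr
      exact Or.inr ⟨q, (continuations_language hq).symm⟩
    · exact Or.inl (Set.not_nonempty_iff_eq_empty.1 hr)
  rintro r₁ r₂ r₃ hL₁ hL₂ h₁₂ h₂₃ ⟨x, hx, ⟨y₁, rfl⟩, ⟨y₂, rfl⟩, ⟨y₃, rfl⟩⟩ he
  by_contra hne
  have drop : ∀ {y : List (Fin A.numLetters)}, (continuations A.language (x ++ y)).Nonempty →
      ∀ j, ∃ q, A.back A.start (x.drop j ++ y) = some q := by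
    rintro y ⟨z, hz⟩ j
    refine exists_back_of_continuations ⟨(x.take j).reverse ++ z, ?_⟩
    have e : (x ++ y).reverse ++ z = (x.drop j ++ y).reverse ++ ((x.take j).reverse ++ z) := by
      rw [← List.append_assoc, ← List.reverse_append, ← List.append_assoc, List.take_append_drop]
    have hz : (x ++ y).reverse ++ z ∈ A.language := hz
    rwa [e] at hz
  choose q₁ hq₁ using drop hL₁
  choose q₂ hq₂ using drop hL₂
  choose q₃ hq₃ using drop (he ▸ hL₁)
  obtain ⟨i, j, hij, heq⟩ := Fintype.exists_ne_map_eq_of_card_lt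
    (fun i : Fin (A.numStates ^ 3 + 1) => (q₁ i, q₂ i, q₃ i)) (by simp; ring_nf; omega)
  wlog hlt : i < j generalizing i j
  · exact this j i hij.symm heq.symm (lt_of_le_of_ne (not_lt.1 hlt) hij.symm)
  simp only [Prod.mk.injEq] at heq
  obtain ⟨e₁, e₂, e₃⟩ := heq
  have hlt' : (i : ℕ) < j := hlt
  set a := x.take i with ha
  set γ := (x.drop i).take (j - i) with hγ
  have hd : x.drop i = γ ++ x.drop j := by
    conv_lhs => rw [← List.take_append_drop (j - i) (x.drop i)]
    rw [List.drop_drop, Nat.add_sub_cancel' hlt'.le]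
  have hsplit : ∀ y, x ++ y = (a ++ γ) ++ (x.drop j ++ y) := fun y => by
    conv_lhs => rw [← List.take_append_drop i x, hd]
    simp [ha]
  have cyc : ∀ {y : List (Fin A.numLetters)} {q q'}, A.back A.start (x.drop i ++ y) = some q →
      A.back A.start (x.drop j ++ y) = some q' → q = q' → A.back q' γ = some q' := by
    rintro y q q' h h' rfl
    rw [hd, List.append_assoc, back_append, h'] at h
    simpa using h
  have hγ' : γ ≠ [] := by
    rw [← List.length_pos_iff, hγ, List.length_take, List.length_drop, hx]
    have := j.2
    omega
  rw [hsplit, hsplit y₂, append_lt_append_left_iff] at h₁₂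
  rw [hsplit, hsplit y₃, append_lt_append_left_iff] at h₂₃
  rw [hsplit] at hL₁ hL₂
  rw [hsplit, hsplit y₃] at he
  rw [hsplit, hsplit y₁] at hne
  exact h (hasPattern_of_cycles hγ' h₁₂ h₂₃ (hq₁ j) (hq₂ j) (hq₃ j) (cyc (hq₁ i) (hq₁ j) e₁)
    (cyc (hq₂ i) (hq₂ j) e₂) (cyc (hq₃ i) (hq₃ j) e₃) hL₁ hL₂ he hne)

theorem isWheelerLanguage_iff : IsWheelerLanguage A.language ↔ ¬ A.HasPattern :=
  ⟨fun h h' => h'.not_isWheelerLanguage h, isWheelerLanguage_of_not_hasPattern⟩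

end EdgeDFA

/-! ### Horn rules for the forbidden pattern -/

theorem getElem?_flatMap_mul_add {α β : Type*} (l : List α) (f : α → List β) {m : ℕ}
    (hf : ∀ x ∈ l, (f x).length = m) (q : ℕ) {a : ℕ} (ha : a < m) :
    (l.flatMap f)[q * m + a]? = l[q]?.bind fun x => (f x)[a]? := by
  induction l generalizing q with
  | nil => simp
  | cons x l ih =>
    have hx := hf x List.mem_cons_self
    have ih := ih fun y hy => hf y (List.mem_cons_of_mem _ hy)
    rw [List.flatMap_cons]
    obtain _ | q := q
    · rw [List.getElem?_append_left (by omega)]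
      simp
    · rw [List.getElem?_append_right (by rw [hx, Nat.succ_mul]; omega)]
      rw [show (q + 1) * m + a - (f x).length = q * m + a by rw [hx, Nat.succ_mul]; omega, ih]
      simp

/-- A decided comparison is not affected by further letters of the cycle label. -/
theorem Diverges.append {α : Type*} [LinearOrder α] {s : Bool} {μ γ : List α}
    (h : Diverges s μ γ) (y : List α) : Diverges s μ (γ ++ y) := by
  cases s
  · simpa [Diverges] using lt_append_of_lt h y
  · exact ⟨append_lt_of_not_prefix h.1 h.2 y, fun h' => h.2 ((List.prefix_append _ _).trans h')⟩

/-- The relation symbols of the program that searches for a pattern. -/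
inductive PatternRel
  | pos | entry | less | final | nonfinal | addr | edge | noEdge | live | reach | sep | turn | walk | goal
deriving DecidableEq

namespace PatternRel

instance : Fintype PatternRel :=
  Fintype.ofList [pos, entry, less, final, nonfinal, addr, edge, noEdge, live, reach, sep, turn, walk,
    goal] fun t => by cases t <;> decide

/-- The arities of the relation symbols. -/
def arity : PatternRel → ℕ
  | pos => 3 | entry => 2 | less => 2 | final => 1 | nonfinal => 1 | addr => 3 | edge => 3
  | noEdge => 2 | live => 1 | reach => 1 | sep => 2 | turn => 4 | walk => 7 | goal => 0

end PatternRel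

namespace EdgeDFA

section Description

variable (A : EdgeDFA)

theorem toList_zero : A.toList[0]? = some A.numStates := rfl

theorem toList_one : A.toList[1]? = some A.numLetters := rfl

theorem toList_two : A.toList[2]? = some (A.start : ℕ) := rfl

theorem toList_accept (q : Fin A.numStates) :
    A.toList[(q : ℕ) + 3]? = some (A.accept q).toNat := by
  rw [toList, List.append_assoc, List.getElem?_append_right (by simp),
    List.getElem?_append_left (by simp)]
  simp

theorem toList_step (q : Fin A.numStates) (a : Fin A.numLetters) :
    A.toList[A.numStates + 3 + q * A.numLetters + a]? =
      some ((A.step q a).elim 0 fun r => (r : ℕ) + 1) := by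
  rw [toList, List.getElem?_append_right (by simp; omega)]
  rw [show A.numStates + 3 + q * A.numLetters + a - _ = q * A.numLetters + a by simp; omega,
    getElem?_flatMap_mul_add _ _ (by simp) _ a.2]
  simp

theorem length_toList : A.toList.length = A.numStates + 3 + A.numStates * A.numLetters := by
  simp [toList, List.length_flatMap]
  omega

end Description

/-- A variable plus a constant. -/
def tm (i : Fin 12) (k : ℕ := 0) : RuleTerm (Fin 12) := ⟨some i, k⟩

/-- A constant term. -/
def ct (k : ℕ) : RuleTerm (Fin 12) := ⟨none, k⟩

open PatternRel in
/-- The rules of the program that searches for a pattern in the automaton described by the input. -/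
def patternRules : List (HornRule (Fin 12) PatternRel) := [
  -- Decoding of the unary code: `pos i v p` says that `v` ones of entry `i` have been read when
  -- position `p` is reached.
  ⟨[], [], (pos, [ct 0, ct 0, ct 0])⟩,
  ⟨[(tm 2, true)], [(pos, [tm 0, tm 1, tm 2])], (pos, [tm 0, tm 1 1, tm 2 1])⟩,
  ⟨[(tm 2, false)], [(pos, [tm 0, tm 1, tm 2])], (pos, [tm 0 1, ct 0, tm 2 1])⟩,
  ⟨[(tm 2, false)], [(pos, [tm 0, tm 1, tm 2])], (entry, [tm 0, tm 1])⟩,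
  ⟨[], [], (less, [tm 0, tm 0 1])⟩,
  ⟨[], [(less, [tm 0, tm 1])], (less, [tm 0, tm 1 1])⟩,
  -- The bits for the final states come after three other entries, hence the offset `3`.
  ⟨[], [(entry, [ct 0, tm 1]), (less, [tm 0, tm 1]), (entry, [tm 0 3, ct 1])], (final, [tm 0])⟩,
  ⟨[], [(entry, [ct 0, tm 1]), (less, [tm 0, tm 1]), (entry, [tm 0 3, ct 0])], (nonfinal, [tm 0])⟩,
  -- `addr q a i`: the transition from `q` by `a` is entry `i`. Terms cannot multiply, so the table
  -- is traversed by counting; the end of one row is the start of the next.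
  ⟨[], [(entry, [ct 0, tm 0])], (addr, [ct 0, ct 0, tm 0 3])⟩,
  ⟨[], [(addr, [tm 0, tm 1, tm 2]), (entry, [ct 1, tm 3]), (less, [tm 1, tm 3])],
    (addr, [tm 0, tm 1 1, tm 2 1])⟩,
  ⟨[], [(addr, [tm 0, tm 1, tm 2]), (entry, [ct 1, tm 1])], (addr, [tm 0 1, ct 0, tm 2])⟩,
  ⟨[], [(addr, [tm 0, tm 1, tm 3]), (entry, [ct 0, tm 4]), (less, [tm 0, tm 4]), (entry, [ct 1, tm 5]),
    (less, [tm 1, tm 5]), (entry, [tm 3, tm 2 1])], (edge, [tm 0, tm 1, tm 2])⟩,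
  ⟨[], [(addr, [tm 0, tm 1, tm 3]), (entry, [ct 0, tm 4]), (less, [tm 0, tm 4]), (entry, [ct 1, tm 5]),
    (less, [tm 1, tm 5]), (entry, [tm 3, ct 0])], (noEdge, [tm 0, tm 1])⟩,
  ⟨[], [(final, [tm 0])], (live, [tm 0])⟩,
  ⟨[], [(edge, [tm 0, tm 1, tm 2]), (live, [tm 2])], (live, [tm 0])⟩,
  ⟨[], [(entry, [ct 2, tm 0])], (reach, [tm 0])⟩,
  ⟨[], [(reach, [tm 0]), (edge, [tm 0, tm 1, tm 2])], (reach, [tm 2])⟩,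
  -- Rejection is expressed positively: the second state is not final, or lacks an edge along which
  -- the first one stays live.
  ⟨[], [(final, [tm 0]), (nonfinal, [tm 1])], (sep, [tm 0, tm 1])⟩,
  ⟨[], [(edge, [tm 0, tm 2, tm 3]), (edge, [tm 1, tm 2, tm 4]), (sep, [tm 3, tm 4])],
    (sep, [tm 0, tm 1])⟩,
  ⟨[], [(edge, [tm 0, tm 2, tm 3]), (noEdge, [tm 1, tm 2]), (live, [tm 3])],
    (sep, [tm 0, tm 1])⟩,
  -- `turn s X' a X`: reading the letter `a` of the cycle label takes the comparison with the access
  -- word from `X` to `X'`. Zero means decided; `x + 1` means agreement so far, with the access word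
  -- traced back to the state `x`. The cases are: equal letters, already decided, smaller letter,
  -- end of the access word, larger letter. The facts `reach` ensure that the rest of the access
  -- word exists.
  ⟨[], [(edge, [tm 1, tm 2, tm 3])], (turn, [tm 0, tm 1 1, tm 2, tm 3 1])⟩,
  ⟨[], [], (turn, [tm 0, ct 0, tm 1, ct 0])⟩,
  ⟨[], [(edge, [tm 0, tm 1, tm 2]), (less, [tm 1, tm 3]), (reach, [tm 0])],
    (turn, [ct 0, ct 0, tm 3, tm 2 1])⟩,
  ⟨[], [(entry, [ct 2, tm 0])], (turn, [ct 0, ct 0, tm 1, tm 0 1])⟩,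
  ⟨[], [(edge, [tm 0, tm 1, tm 2]), (less, [tm 3, tm 1]), (reach, [tm 0])],
    (turn, [ct 1, ct 0, tm 3, tm 2 1])⟩,
  -- `walk s u v X Y c d`: both cycles have been followed backwards along one word, from `u`, `v` to
  -- `c`, `d`, with comparisons `X`, `Y`. The goal asks for a return to `u`, `v` with both
  -- comparisons decided, which excludes the empty cycle.
  ⟨[], [], (walk, [tm 0, tm 1, tm 2, tm 1 1, tm 2 1, tm 1, tm 2])⟩,
  ⟨[], [(walk, [tm 0, tm 1, tm 2, tm 3, tm 4, tm 5, tm 6]), (turn, [tm 0, tm 7, tm 11, tm 3]),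
    (turn, [tm 0, tm 8, tm 11, tm 4]), (edge, [tm 9, tm 11, tm 5]),
    (edge, [tm 10, tm 11, tm 6])], (walk, [tm 0, tm 1, tm 2, tm 7, tm 8, tm 9, tm 10])⟩,
  ⟨[], [(walk, [tm 0, tm 1, tm 2, ct 0, ct 0, tm 1, tm 2]), (sep, [tm 1, tm 2]),
    (live, [tm 2])], (goal, [])⟩]

/-- The program that searches for a pattern in the automaton described by the input. -/
def patternProgram : HornProgram (Fin 12) PatternRel where
  rules := patternRules
  arity := PatternRel.arity
  maxConst := 3
  body_arity := by decide
  body_const := by decide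
  head_arity := by decide
  head_const := by decide

/-! ### Soundness of the rules -/

section Soundness

variable (A : EdgeDFA)

/-- The state of the comparison of some word leading to the state `u` with a word that begins with
`ζ`, both reversed: decided (if `X = 0`), or the two agree on `ζ` (if `X = x + 1` for the state `x`
before `ζ`). -/
def Trace (s X : ℕ) (ζ : List (Fin A.numLetters)) (u : Fin A.numStates) : Prop :=
  (X = 0 ∧ ∃ μ, A.back A.start μ = some u ∧ Diverges (decide (s = 1)) μ ζ) ∨
    ∃ x : Fin A.numStates, X = x + 1 ∧ A.back x ζ = some u

open PatternRel in
/-- The meanings of the relation symbols of the program that searches for a pattern. -/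
def Meaning : PatternRel → List ℕ → Prop
  | pos, [i, v, p] => A.encode.drop p =
      ((A.toList.drop i).flatMap fun m => List.replicate m true ++ [false]).drop v ∧
      v ≤ A.toList.getD i 0
  | entry, [i, v] => A.toList[i]? = some v
  | less, [x, y] => x < y
  | final, [q] => ∃ h, A.accept ⟨q, h⟩ = true
  | nonfinal, [q] => ∃ h, A.accept ⟨q, h⟩ = false
  | addr, [q, a, i] => i = A.numStates + 3 + q * A.numLetters + a ∧ a ≤ A.numLetters
  | edge, [q, a, r] => ∃ hq ha hr, A.step ⟨q, hq⟩ ⟨a, ha⟩ = some ⟨r, hr⟩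
  | noEdge, [q, a] => ∃ hq ha, A.step ⟨q, hq⟩ ⟨a, ha⟩ = none
  | live, [q] => ∃ h z, A.Accepts ⟨q, h⟩ z
  | reach, [q] => ∃ h r, A.back A.start r = some ⟨q, h⟩
  | sep, [u, v] => ∃ hu hv z, A.Accepts ⟨u, hu⟩ z ∧ ¬ A.Accepts ⟨v, hv⟩ z
  -- Here and for `walk`, the range conditions are premises, because rules with empty bodies derive
  -- such facts also for numbers that are not letters or states.
  | turn, [s, X', a, X] => ∀ ha u ζ, A.Trace s X ζ u → A.Trace s X' (ζ ++ [⟨a, ha⟩]) u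
  | walk, [s, u, v, X, Y, c, d] => ∀ hu hv, ∃ hc hd ζ, A.back ⟨c, hc⟩ ζ = some ⟨u, hu⟩ ∧
      A.back ⟨d, hd⟩ ζ = some ⟨v, hv⟩ ∧ A.Trace s X ζ ⟨u, hu⟩ ∧ A.Trace s Y ζ ⟨v, hv⟩
  | goal, [] => A.HasPattern
  | _, _ => False

variable {A}

theorem accepts_nil {q : Fin A.numStates} : A.Accepts q [] ↔ A.accept q = true := by
  simp [Accepts, run]

theorem accepts_cons {q r : Fin A.numStates} {a : Fin A.numLetters} (h : A.step q a = some r)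
    (z : List (Fin A.numLetters)) : A.Accepts q (a :: z) ↔ A.Accepts r z := by
  simp [Accepts, run, h]

theorem not_accepts_cons {q : Fin A.numStates} {a : Fin A.numLetters} (h : A.step q a = none)
    (z : List (Fin A.numLetters)) : ¬ A.Accepts q (a :: z) := by
  simp [Accepts, run, h]

theorem back_concat {q r u : Fin A.numStates} {a : Fin A.numLetters} (h : A.step q a = some r)
    {ζ : List (Fin A.numLetters)} (hr : A.back r ζ = some u) : A.back q (ζ ++ [a]) = some u := by
  simp [back_append, back, h, hr]

theorem back_append_cons {x' x u : Fin A.numStates} {b : Fin A.numLetters}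
    {ζ ρ : List (Fin A.numLetters)} (hρ : A.back A.start ρ = some x') (h : A.step x' b = some x)
    (hu : A.back x ζ = some u) : A.back A.start (ζ ++ b :: ρ) = some u := by
  simp [back_append, back, hρ, h, hu]

theorem Trace.of_zero {s : ℕ} {ζ : List (Fin A.numLetters)} {u : Fin A.numStates}
    (h : A.Trace s 0 ζ u) : ∃ μ, A.back A.start μ = some u ∧ Diverges (decide (s = 1)) μ ζ := by
  rcases h with ⟨-, h⟩ | ⟨x, hx, -⟩
  · exact h
  · omega

theorem Trace.of_succ {s x : ℕ} {ζ : List (Fin A.numLetters)} {u : Fin A.numStates}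
    (h : A.Trace s (x + 1) ζ u) : ∃ hx, A.back ⟨x, hx⟩ ζ = some u := by
  rcases h with ⟨h, -⟩ | ⟨y, hy, h⟩
  · omega
  · obtain rfl : x = y := by omega
    exact ⟨y.2, h⟩

/-- A letter at position `p` shows that the description is not exhausted, so entry `i` exists. The
letter itself then tells whether `v < m` or `v = m`. -/
theorem meaning_pos {i v p : ℕ} (h : A.Meaning .pos [i, v, p]) {b : Bool}
    (hb : A.encode[p]? = some b) :
    ∃ m, A.toList[i]? = some m ∧ A.encode.drop p = List.replicate (m - v) true ++ [false] ++
      ((A.toList.drop (i + 1)).flatMap fun m => List.replicate m true ++ [false]) ∧ v ≤ m := by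
  obtain ⟨h, hv⟩ := h
  rcases hm : A.toList[i]? with _ | m
  · rw [List.drop_eq_nil_of_le (List.getElem?_eq_none_iff.1 hm)] at h
    rw [← List.head?_drop, h] at hb
    simp at hb
  · obtain ⟨hi, hm'⟩ := List.getElem?_eq_some_iff.1 hm
    rw [List.getD_eq_getElem?_getD, hm] at hv
    refine ⟨m, rfl, ?_, hv⟩
    rw [h, List.drop_eq_getElem_cons hi, hm', List.flatMap_cons, List.append_assoc,
      List.drop_append_of_le_length (by simpa using hv)]
    simp

theorem meaning_step {q a i r n m : ℕ} (h : A.Meaning .addr [q, a, i])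
    (hn : A.Meaning .entry [0, n]) (hq : A.Meaning .less [q, n]) (hm : A.Meaning .entry [1, m])
    (ha : A.Meaning .less [a, m]) (hr : A.Meaning .entry [i, r]) :
    ∃ hq ha, (A.step ⟨q, hq⟩ ⟨a, ha⟩).elim 0 (fun r => (r : ℕ) + 1) = r := by
  obtain rfl : A.numStates = n := Option.some.inj hn
  obtain rfl : A.numLetters = m := Option.some.inj hm
  refine ⟨hq, ha, ?_⟩
  have := A.toList_step ⟨q, hq⟩ ⟨a, ha⟩
  obtain ⟨rfl, -⟩ := h
  exact Option.some.inj (this.symm.trans hr)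

theorem meaning_accept {q n b : ℕ} (hn : A.Meaning .entry [0, n]) (hq : A.Meaning .less [q, n])
    (hb : A.Meaning .entry [q + 3, b]) : ∃ h, (A.accept ⟨q, h⟩).toNat = b := by
  obtain rfl : A.numStates = n := Option.some.inj hn
  exact ⟨hq, Option.some.inj ((A.toList_accept ⟨q, hq⟩).symm.trans hb)⟩

/-- The meanings are closed under the rules, and the derivable facts are the least such family. The
cases follow the order of `patternRules`. -/
theorem meaning_of_rule {ρ : HornRule (Fin 12) PatternRel} (hρ : ρ ∈ patternRules) (ν : Fin 12 → ℕ)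
    (hi : ∀ l ∈ ρ.inputs, A.encode[l.1.val ν]? = some l.2)
    (hb : ∀ l ∈ ρ.body, A.Meaning l.1 (l.2.map (RuleTerm.val ν))) :
    A.Meaning ρ.head.1 (ρ.head.2.map (RuleTerm.val ν)) := by
  simp only [patternRules, List.mem_cons, List.not_mem_nil, or_false] at hρ
  rcases hρ with rfl | rfl | rfl | rfl | rfl | rfl | rfl | rfl | rfl | rfl | rfl | rfl | rfl | rfl |
    rfl | rfl | rfl | rfl | rfl | rfl | rfl | rfl | rfl | rfl | rfl | rfl | rfl | rfl
  all_goals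
    simp only [List.forall_mem_cons, List.map_cons, List.map_nil, RuleTerm.val, tm, ct,
      Option.elim_some, Option.elim_none, Nat.add_zero, Nat.zero_add, List.not_mem_nil, false_imp_iff,
      implies_true, and_true] at hi hb ⊢
  · exact ⟨rfl, Nat.zero_le _⟩
  · obtain ⟨m, hm, h, hv⟩ := meaning_pos hb hi
    rw [← List.head?_drop, h] at hi
    rcases hk : m - ν 1 with _ | k
    · simp [hk] at hi
    · have hlt : ν 1 + 1 ≤ m := by omega
      refine ⟨?_, by simpa [List.getD_eq_getElem?_getD, hm] using hlt⟩
      obtain ⟨hi', hm'⟩ := List.getElem?_eq_some_iff.1 hm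
      rw [← List.drop_drop, h, List.drop_eq_getElem_cons hi', hm', List.flatMap_cons,
        List.append_assoc, List.append_assoc, List.drop_append_of_le_length (by simp; omega),
        List.drop_append_of_le_length (by simpa using hlt)]
      simp [Nat.sub_sub]
  · obtain ⟨m, hm, h, hv⟩ := meaning_pos hb hi
    rw [← List.head?_drop, h] at hi
    rcases hk : m - ν 1 with _ | k
    · exact ⟨by rw [← List.drop_drop, h, hk]; rfl, Nat.zero_le _⟩
    · simp [hk, List.replicate_succ] at hi
  · obtain ⟨m, hm, h, hv⟩ := meaning_pos hb hi
    rw [← List.head?_drop, h] at hi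
    rcases hk : m - ν 1 with _ | k
    · obtain rfl : m = ν 1 := by omega
      exact hm
    · simp [hk, List.replicate_succ] at hi
  · exact Nat.lt_succ_self _
  · exact Nat.lt_succ_of_lt hb
  · obtain ⟨h, h'⟩ := meaning_accept hb.1 hb.2.1 hb.2.2
    exact ⟨h, by simpa using h'⟩
  · obtain ⟨h, h'⟩ := meaning_accept hb.1 hb.2.1 hb.2.2
    exact ⟨h, by simpa using h'⟩
  · obtain h : A.numStates = _ := Option.some.inj hb
    exact ⟨by rw [← h]; simp, Nat.zero_le _⟩
  · obtain ⟨⟨h, _⟩, hm, ha⟩ := hb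
    obtain hm : A.numLetters = _ := Option.some.inj hm
    exact ⟨by rw [h]; rfl, hm ▸ ha⟩
  · obtain ⟨⟨h, _⟩, hm⟩ := hb
    obtain hm : A.numLetters = _ := Option.some.inj hm
    exact ⟨by rw [h, ← hm]; ring, Nat.zero_le _⟩
  · obtain ⟨h₁, h₂, h₃, h₄, h₅, h₆⟩ := hb
    obtain ⟨hq, ha, h⟩ := meaning_step h₁ h₂ h₃ h₄ h₅ h₆
    rcases hr : A.step ⟨ν 0, hq⟩ ⟨ν 1, ha⟩ with _ | r
    · simp [hr] at h
    · have h : (r : ℕ) = ν 2 := by simpa [hr] using h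
      exact ⟨hq, ha, h ▸ r.2, by rw [hr]; exact congrArg some (Fin.ext h)⟩
  · obtain ⟨h₁, h₂, h₃, h₄, h₅, h₆⟩ := hb
    obtain ⟨hq, ha, h⟩ := meaning_step h₁ h₂ h₃ h₄ h₅ h₆
    rcases hr : A.step ⟨ν 0, hq⟩ ⟨ν 1, ha⟩ with _ | r
    · exact ⟨hq, ha, hr⟩
    · simp [hr] at h
  · obtain ⟨h, h'⟩ := hb
    exact ⟨h, [], accepts_nil.2 h'⟩
  · obtain ⟨⟨hq, ha, hr, h⟩, _, z, hz⟩ := hb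
    exact ⟨hq, ⟨_, ha⟩ :: z, (accepts_cons h z).2 hz⟩
  · obtain h : (A.start : ℕ) = _ := Option.some.inj hb
    exact ⟨h ▸ A.start.2, [], by simp [back, Fin.ext_iff, h]⟩
  · obtain ⟨⟨_, ρ, hρ⟩, hq, ha, hr, h⟩ := hb
    exact ⟨hr, ⟨_, ha⟩ :: ρ, by simp [back, hρ, h]⟩
  · obtain ⟨⟨hu, hu'⟩, hv, hv'⟩ := hb
    exact ⟨hu, hv, [], accepts_nil.2 hu', by simp [accepts_nil, hv']⟩
  · obtain ⟨⟨hu, ha, hu', h⟩, ⟨hv, _, hv', h'⟩, _, _, z, hz, hz'⟩ := hb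
    exact ⟨hu, hv, ⟨_, ha⟩ :: z, (accepts_cons h z).2 hz, by rwa [accepts_cons h']⟩
  · obtain ⟨⟨hu, ha, hu', h⟩, ⟨hv, _, h'⟩, _, z, hz⟩ := hb
    exact ⟨hu, hv, ⟨_, ha⟩ :: z, (accepts_cons h z).2 hz, not_accepts_cons h' z⟩
  · intro ha u ζ h
    obtain ⟨hx, _, hx', h'⟩ := hb
    obtain ⟨_, h⟩ := h.of_succ
    exact Or.inr ⟨⟨_, hx⟩, rfl, back_concat h' h⟩
  · intro ha u ζ h
    obtain ⟨μ, hμ, h⟩ := h.of_zero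
    exact Or.inl ⟨rfl, μ, hμ, h.append _⟩
  · intro ha u ζ h
    obtain ⟨⟨hx, hb, hx', h'⟩, hlt, _, ρ, hρ⟩ := hb
    obtain ⟨_, h⟩ := h.of_succ
    refine Or.inl ⟨rfl, _, back_append_cons hρ h' h, ?_⟩
    have : (⟨ν 1, hb⟩ : Fin A.numLetters) < ⟨ν 3, ha⟩ := hlt
    simp [Diverges, append_lt_append_left_iff, List.cons_lt_cons_iff, this]
  · intro ha u ζ h
    obtain hs : (A.start : ℕ) = _ := Option.some.inj hb
    obtain ⟨h₀, h⟩ := h.of_succ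
    have hs : A.start = ⟨ν 0, h₀⟩ := Fin.ext hs
    refine Or.inl ⟨rfl, ζ, hs ▸ h, ?_⟩
    simpa [Diverges] using (append_lt_append_left_iff (x := ζ)).2 (List.nil_lt_cons _ [])
  · intro ha u ζ h
    obtain ⟨⟨hx, hb, hx', h'⟩, hlt, _, ρ, hρ⟩ := hb
    obtain ⟨_, h⟩ := h.of_succ
    refine Or.inl ⟨rfl, _, back_append_cons hρ h' h, ?_⟩
    have : (⟨ν 3, ha⟩ : Fin A.numLetters) < ⟨ν 1, hb⟩ := hlt
    simp [Diverges, append_lt_append_left_iff, List.cons_lt_cons_iff, this, this.ne]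
  · exact fun hu hv => ⟨hu, hv, [], rfl, rfl, Or.inr ⟨⟨_, hu⟩, rfl, rfl⟩, Or.inr ⟨⟨_, hv⟩, rfl, rfl⟩⟩
  · intro hu hv
    obtain ⟨hw, hX, hY, ⟨hc', ha, _, hc⟩, hd', _, _, hd⟩ := hb
    obtain ⟨_, _, ζ, hu', hv', hX', hY'⟩ := hw hu hv
    exact ⟨hc', hd', ζ ++ [⟨_, ha⟩], back_concat hc hu', back_concat hd hv', hX ha _ _ hX',
      hY ha _ _ hY'⟩
  · obtain ⟨hw, ⟨hu, hv, hz⟩, _, hl⟩ := hb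
    obtain ⟨_, _, γ, hu', hv', hX, hY⟩ := hw hu hv
    obtain ⟨μ, hμ, hμγ⟩ := hX.of_zero
    obtain ⟨ξ, hξ, hξγ⟩ := hY.of_zero
    exact ⟨_, ⟨_, hu⟩, ⟨_, hv⟩, γ, μ, ξ, hu', hv', hμ, hξ, hμγ, hξγ, hz, hl⟩

theorem meaning_of_derives {t : PatternRel} {l : List ℕ}
    (h : patternProgram.Derives A.encode t l) : A.Meaning t l := by
  induction h with
  | rule ρ hρ ν hν hi hb ih => exact meaning_of_rule hρ ν hi ih

end Soundness

end EdgeDFA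

/-! ### Completeness of the rules -/

namespace EdgeDFA

section Completeness

/-- Use of a rule of the program that searches for a pattern, given by its index and the values of
the variables. -/
theorem derives_rule {w : List Bool} (k : ℕ) (hk : k < patternRules.length) (vs : List ℕ)
    (hvs : ∀ x ∈ vs, x ≤ w.length)
    (hi : patternRules[k].inputs.Forall fun l =>
      w[l.1.val fun i : Fin 12 => vs.getD i 0]? = some l.2)
    (hb : patternRules[k].body.Forall fun l =>
      patternProgram.Derives w l.1 (l.2.map (RuleTerm.val fun i : Fin 12 => vs.getD i 0))) :
    patternProgram.Derives w patternRules[k].head.1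
      (patternRules[k].head.2.map (RuleTerm.val fun i : Fin 12 => vs.getD i 0)) := by
  refine .rule _ (List.getElem_mem hk) _ (fun i => ?_) (List.forall_iff_forall_mem.1 hi)
    (List.forall_iff_forall_mem.1 hb)
  rcases h : vs[(i : ℕ)]? with _ | x
  · simp [List.getD_eq_getElem?_getD, h]
  · simpa [List.getD_eq_getElem?_getD, h] using hvs x (List.mem_of_getElem? h)

theorem derives_pos_add {w : List Bool} {i p m : ℕ} {y : List Bool}
    (hw : w.drop p = List.replicate m true ++ y) (hi : i ≤ p)
    (h : patternProgram.Derives w .pos [i, 0, p]) :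
    ∀ v ≤ m, patternProgram.Derives w .pos [i, v, p + v]
  | 0, _ => h
  | v + 1, hv => by
    have hb : w[p + v]? = some true := by
      rw [← List.getElem?_drop, hw, List.getElem?_append_left (by simpa using hv)]
      exact List.getElem?_replicate_of_lt hv
    have hlt := (List.getElem?_eq_some_iff.1 hb).1
    have := derives_pos_add hw hi h v (by omega)
    exact derives_rule 1 (by decide) [i, v, p + v] (by simp; omega) hb this

variable (A : EdgeDFA)

/-- An entry of value `m` takes `m` uses of the rule for ones and one of the rule for zero. The
bound `i ≤ p` keeps the index within the range of the variables. -/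
theorem exists_derives_pos : ∀ i ≤ A.toList.length, ∃ p, i ≤ p ∧
    A.encode.drop p = ((A.toList.drop i).flatMap fun m => List.replicate m true ++ [false]) ∧
    patternProgram.Derives A.encode .pos [i, 0, p]
  | 0, _ => ⟨0, le_rfl, rfl, derives_rule 0 (by decide) [] (by simp) trivial trivial⟩
  | i + 1, hi => by
    obtain ⟨p, hp, hd, h⟩ := exists_derives_pos i (by omega)
    rw [List.drop_eq_getElem_cons hi, List.flatMap_cons, List.append_assoc] at hd
    set m := A.toList[i]
    have hb : A.encode[p + m]? = some false := by
      rw [← List.getElem?_drop, hd, List.getElem?_append_right (by simp)]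
      simp
    have hlt := (List.getElem?_eq_some_iff.1 hb).1
    refine ⟨p + m + 1, by omega, ?_, ?_⟩
    · rw [add_assoc, ← List.drop_drop, hd, ← List.append_assoc]
      exact List.drop_left' (by simp)
    · exact derives_rule 2 (by decide) [i, m, p + m] (by simp; omega) hb
        (derives_pos_add hd hp h m le_rfl)

theorem derives_entry {i m : ℕ} (hm : A.toList[i]? = some m) : i ≤ A.encode.length ∧
    m ≤ A.encode.length ∧ patternProgram.Derives A.encode .entry [i, m] := by
  obtain ⟨hi, hm⟩ := List.getElem?_eq_some_iff.1 hm
  obtain ⟨p, hp, hd, h⟩ := A.exists_derives_pos i hi.le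
  rw [List.drop_eq_getElem_cons hi, List.flatMap_cons, List.append_assoc, hm] at hd
  have hb : A.encode[p + m]? = some false := by
    rw [← List.getElem?_drop, hd, List.getElem?_append_right (by simp)]
    simp
  have hlt := (List.getElem?_eq_some_iff.1 hb).1
  exact ⟨by omega, by omega, derives_rule 3 (by decide) [i, m, p + m] (by simp; omega) hb
    (derives_pos_add hd hp h m le_rfl)⟩

theorem length_toList_le : A.toList.length ≤ A.encode.length := by
  rw [encode, List.length_flatMap]
  simp [List.sum_map_add]

theorem numStates_le : A.numStates ≤ A.encode.length := (A.derives_entry A.toList_zero).2.1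

theorem numLetters_le : A.numLetters ≤ A.encode.length := (A.derives_entry A.toList_one).2.1

variable {A}

theorem state_lt (q : Fin A.numStates) : q < A.encode.length := q.2.trans_le A.numStates_le

theorem letter_lt (a : Fin A.numLetters) : a < A.encode.length := a.2.trans_le A.numLetters_le

theorem derives_less {w : List Bool} {x y : ℕ} (h : x < y) (hy : y ≤ w.length) :
    patternProgram.Derives w .less [x, y] := by
  induction y, Nat.succ_le_of_lt h using Nat.le_induction with
  | base => exact derives_rule 4 (by decide) [x] (by simp; omega) trivial trivial
  | succ y hxy ih =>
    exact derives_rule 5 (by decide) [x, y] (by simp; omega) trivial (ih hxy (by omega))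

theorem derives_state_less (q : Fin A.numStates) :
    patternProgram.Derives A.encode .less [q, A.numStates] := derives_less q.2 A.numStates_le

theorem derives_letter_less (a : Fin A.numLetters) :
    patternProgram.Derives A.encode .less [a, A.numLetters] := derives_less a.2 A.numLetters_le

theorem derives_numStates : patternProgram.Derives A.encode .entry [0, A.numStates] :=
  (A.derives_entry A.toList_zero).2.2

theorem derives_numLetters : patternProgram.Derives A.encode .entry [1, A.numLetters] :=
  (A.derives_entry A.toList_one).2.2

theorem derives_final {q : Fin A.numStates} (h : A.accept q = true) :
    patternProgram.Derives A.encode .final [q] := by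
  have := (A.derives_entry (A.toList_accept q)).2.2
  rw [h] at this
  exact derives_rule 6 (by decide) [q, A.numStates] (by simp [(state_lt q).le, numStates_le]) trivial
    ⟨derives_numStates, derives_state_less q, this⟩

theorem derives_nonfinal {q : Fin A.numStates} (h : A.accept q = false) :
    patternProgram.Derives A.encode .nonfinal [q] := by
  have := (A.derives_entry (A.toList_accept q)).2.2
  rw [h] at this
  exact derives_rule 7 (by decide) [q, A.numStates] (by simp [(state_lt q).le, numStates_le]) trivial
    ⟨derives_numStates, derives_state_less q, this⟩

/-- Variables only range up to the length of the input, so addresses have to stay below it. The case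
`a = numLetters` occurs at the end of a row. -/
theorem addr_le {q a : ℕ} (hq : q < A.numStates) (ha : a ≤ A.numLetters) :
    A.numStates + 3 + q * A.numLetters + a ≤ A.encode.length := by
  refine le_trans ?_ A.length_toList_le
  rw [length_toList]
  have := Nat.mul_le_mul_right A.numLetters (Nat.succ_le_of_lt hq)
  rw [Nat.succ_mul] at this
  omega

theorem derives_addr {q : ℕ} (hq : q < A.numStates) {a : ℕ} (ha : a ≤ A.numLetters) :
    patternProgram.Derives A.encode .addr [q, a, A.numStates + 3 + q * A.numLetters + a] := by
  induction q generalizing a with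
  | zero =>
    induction a with
    | zero =>
      rw [Nat.zero_mul]
      exact derives_rule 8 (by decide) [A.numStates] (by simp [numStates_le]) trivial
        derives_numStates
    | succ a ih =>
      have hle := addr_le hq ha
      exact derives_rule 9 (by decide)
        [0, a, A.numStates + 3 + 0 * A.numLetters + a, A.numLetters]
        (by have := A.numLetters_le; simp at hle ⊢; omega) trivial
        ⟨ih (by omega), derives_numLetters, derives_less ha A.numLetters_le⟩
  | succ q ihq =>
    induction a with
    | zero =>
      have := ihq (by omega) le_rfl
      rw [Nat.succ_mul, ← add_assoc]
      exact derives_rule 10 (by decide)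
        [q, A.numLetters, A.numStates + 3 + q * A.numLetters + A.numLetters]
        (by
          have := A.numLetters_le
          have := A.numStates_le
          have := addr_le (A := A) (Nat.lt_of_succ_lt hq) le_rfl
          simp; omega) trivial ⟨this, derives_numLetters⟩
    | succ a ih =>
      have hle := addr_le hq ha
      exact derives_rule 9 (by decide)
        [q + 1, a, A.numStates + 3 + (q + 1) * A.numLetters + a, A.numLetters]
        (by
          have := A.numLetters_le
          have := A.numStates_le
          simp; omega) trivial
        ⟨ih (by omega), derives_numLetters, derives_less ha A.numLetters_le⟩

theorem derives_edge {q r : Fin A.numStates} {a : Fin A.numLetters} (h : A.step q a = some r) :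
    patternProgram.Derives A.encode .edge [q, a, r] := by
  have := (A.derives_entry (A.toList_step q a)).2.2
  rw [h] at this
  exact derives_rule 11 (by decide) [q, a, r, A.numStates + 3 + q * A.numLetters + a, A.numStates,
      A.numLetters]
    (by simp [(state_lt _).le, (letter_lt _).le, numStates_le, numLetters_le, addr_le q.2 a.2.le])
    trivial ⟨derives_addr q.2 a.2.le, derives_numStates, derives_state_less q, derives_numLetters,
      derives_letter_less a, this⟩

theorem derives_noEdge {q : Fin A.numStates} {a : Fin A.numLetters} (h : A.step q a = none) :
    patternProgram.Derives A.encode .noEdge [q, a] := by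
  have := (A.derives_entry (A.toList_step q a)).2.2
  rw [h] at this
  exact derives_rule 12 (by decide) [q, a, 0, A.numStates + 3 + q * A.numLetters + a, A.numStates,
      A.numLetters]
    (by simp [(state_lt _).le, (letter_lt _).le, numStates_le, numLetters_le, addr_le q.2 a.2.le])
    trivial ⟨derives_addr q.2 a.2.le, derives_numStates, derives_state_less q, derives_numLetters,
      derives_letter_less a, this⟩

theorem derives_live {z : List (Fin A.numLetters)} {q : Fin A.numStates} (h : A.Accepts q z) :
    patternProgram.Derives A.encode .live [q] := by
  induction z generalizing q with
  | nil =>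
    exact derives_rule 13 (by decide) [q] (by simp [(state_lt _).le]) trivial
      (derives_final (accepts_nil.1 h))
  | cons a z ih =>
    rcases hr : A.step q a with _ | r
    · exact absurd h (not_accepts_cons hr z)
    · exact derives_rule 14 (by decide) [q, a, r] (by simp [(state_lt _).le, (letter_lt _).le]) trivial
        ⟨derives_edge hr, ih ((accepts_cons hr z).1 h)⟩

theorem derives_reach {ρ : List (Fin A.numLetters)} {q : Fin A.numStates}
    (h : A.back A.start ρ = some q) : patternProgram.Derives A.encode .reach [q] := by
  induction ρ generalizing q with
  | nil =>
    obtain rfl : A.start = q := Option.some.inj h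
    exact derives_rule 15 (by decide) [A.start] (by simp [(state_lt _).le]) trivial
      (A.derives_entry A.toList_two).2.2
  | cons a ρ ih =>
    obtain ⟨p, hp, hq⟩ := Option.bind_eq_some_iff.1 h
    exact derives_rule 16 (by decide) [p, a, q] (by simp [(state_lt _).le, (letter_lt _).le]) trivial
      ⟨ih hp, derives_edge hq⟩

theorem derives_sep {z : List (Fin A.numLetters)} {u v : Fin A.numStates} (hu : A.Accepts u z)
    (hv : ¬ A.Accepts v z) : patternProgram.Derives A.encode .sep [u, v] := by
  induction z generalizing u v with
  | nil =>
    rw [accepts_nil, Bool.not_eq_true] at hv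
    exact derives_rule 17 (by decide) [u, v] (by simp [(state_lt _).le]) trivial
      ⟨derives_final (accepts_nil.1 hu), derives_nonfinal hv⟩
  | cons a z ih =>
    rcases hu' : A.step u a with _ | u'
    · exact absurd hu (not_accepts_cons hu' z)
    rw [accepts_cons hu'] at hu
    rcases hv' : A.step v a with _ | v'
    · exact derives_rule 19 (by decide) [u, v, a, u'] (by simp [(state_lt _).le, (letter_lt _).le])
        trivial ⟨derives_edge hu', derives_noEdge hv', derives_live hu⟩
    · rw [accepts_cons hv'] at hv
      exact derives_rule 18 (by decide) [u, v, a, u', v']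
        (by simp [(state_lt _).le, (letter_lt _).le])
        trivial ⟨derives_edge hu', derives_edge hv', ih hu hv⟩

/-- `X` is a possible value for the state of the comparison of `μ` with a word that begins with `ζ`:
decided, or the two agree on `ζ`. -/
def Agrees (A : EdgeDFA) (μ ζ : List (Fin A.numLetters)) (X : ℕ) : Prop :=
  X = 0 ∨ ∃ (x : Fin A.numStates) (ρ : _), X = x + 1 ∧ μ = ζ ++ ρ ∧ A.back A.start ρ = some x

theorem Agrees.le {μ ζ : List (Fin A.numLetters)} {X : ℕ} (h : A.Agrees μ ζ X) :
    X ≤ A.encode.length := by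
  rcases h with rfl | ⟨x, ρ, rfl, -⟩
  · exact Nat.zero_le _
  · exact state_lt x

/-- On either side, divergence prevents `γ` from being a prefix of `μ`, so the comparison is decided
when all of `γ` has been read. -/
theorem Agrees.eq_zero {s : Bool} {μ γ : List (Fin A.numLetters)} {X : ℕ} (h : A.Agrees μ γ X)
    (hs : Diverges s μ γ) : X = 0 := by
  rcases h with h | ⟨x, ρ, -, rfl, -⟩
  · exact h
  · cases s
    · have : γ ++ ρ < γ ++ [] := by simpa [Diverges] using hs
      rw [append_lt_append_left_iff] at this
      simp at this
    · exact absurd (List.prefix_append γ ρ) hs.2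

theorem toNat_le (s : Bool) : s.toNat ≤ A.encode.length :=
  (Bool.toNat_le s).trans (Nat.one_le_iff_ne_zero.2 fun h => absurd (state_lt A.start) (by omega))

/-- The side restricts the point of disagreement: on the lower side `μ` ends or has the smaller
letter, on the upper side it has the larger letter and cannot end. The other cases contradict `hs`
once the common part `ζ` is cancelled. -/
theorem exists_derives_turn {s : Bool} {μ ζ η : List (Fin A.numLetters)} {a : Fin A.numLetters}
    (hs : Diverges s μ (ζ ++ a :: η)) {X : ℕ} (h : A.Agrees μ ζ X) :
    ∃ X', A.Agrees μ (ζ ++ [a]) X' ∧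
      patternProgram.Derives A.encode .turn [s.toNat, X', a, X] := by
  rcases h with rfl | ⟨x, ρ, rfl, rfl, hρ⟩
  · exact ⟨0, Or.inl rfl, derives_rule 21 (by decide) [s.toNat, a]
      (by simp [(letter_lt _).le, toNat_le]) trivial trivial⟩
  obtain _ | ⟨b, ρ⟩ := ρ
  · obtain rfl : A.start = x := Option.some.inj hρ
    cases s
    · exact ⟨0, Or.inl rfl, derives_rule 23 (by decide) [A.start, a]
        (by simp [(letter_lt _).le, (state_lt _).le]) trivial (A.derives_entry A.toList_two).2.2⟩
    · have := hs.1
      rw [append_lt_append_left_iff] at this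
      simp at this
  obtain ⟨x', hx', hx⟩ := Option.bind_eq_some_iff.1 hρ
  rcases lt_trichotomy b a with hab | rfl | hab
  · cases s
    · exact ⟨0, Or.inl rfl, derives_rule 22 (by decide) [x', b, x, a]
        (by simp [(letter_lt _).le, (state_lt _).le]) trivial
        ⟨derives_edge hx, derives_less hab (letter_lt a).le, derives_reach hx'⟩⟩
    · have := hs.1
      rw [append_lt_append_left_iff, List.cons_lt_cons_iff] at this
      rcases this with h | ⟨h, -⟩
      · exact absurd h hab.asymm
      · exact absurd h hab.ne'
  · exact ⟨x' + 1, Or.inr ⟨x', ρ, rfl, by simp, hx'⟩, derives_rule 20 (by decide) [s.toNat, x', b, x]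
      (by simp [(letter_lt _).le, (state_lt _).le, toNat_le]) trivial (derives_edge hx)⟩
  · cases s
    · have : ζ ++ b :: ρ < ζ ++ a :: η := by simpa [Diverges] using hs
      rw [append_lt_append_left_iff, List.cons_lt_cons_iff] at this
      rcases this with h | ⟨h, -⟩
      · exact absurd h hab.asymm
      · exact absurd h hab.ne'
    · exact ⟨0, Or.inl rfl, derives_rule 24 (by decide) [x', b, x, a]
        (by simp [(letter_lt _).le, (state_lt _).le]) trivial
        ⟨derives_edge hx, derives_less hab (letter_lt b).le, derives_reach hx'⟩⟩

/-- Induction on the part `ζ` of the label already read; the unread part `η` leads from `u` and `v`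
to the current states `c` and `d`. -/
theorem exists_derives_walk {s : Bool} {u v : Fin A.numStates} {γ μ ν : List (Fin A.numLetters)}
    (hu : A.back u γ = some u) (hv : A.back v γ = some v) (hμ : A.back A.start μ = some u)
    (hν : A.back A.start ν = some v) (hμγ : Diverges s μ γ) (hνγ : Diverges s ν γ)
    (ζ : List (Fin A.numLetters)) : ∀ η, γ = ζ ++ η → ∃ (X Y : ℕ) (c d : Fin A.numStates),
      A.back u η = some c ∧ A.back v η = some d ∧ A.Agrees μ ζ X ∧ A.Agrees ν ζ Y ∧
      patternProgram.Derives A.encode .walk [s.toNat, u, v, X, Y, c, d] := by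
  induction ζ using List.reverseRecOn with
  | nil =>
    rintro _ rfl
    exact ⟨u + 1, v + 1, u, v, hu, hv, Or.inr ⟨u, μ, rfl, rfl, hμ⟩, Or.inr ⟨v, ν, rfl, rfl, hν⟩,
      derives_rule 25 (by decide) [s.toNat, u, v] (by simp [(state_lt _).le, toNat_le]) trivial
        trivial⟩
  | append_singleton ζ a ih =>
    intro η hη
    rw [List.append_assoc] at hη
    obtain ⟨X, Y, c, d, hc, hd, hX, hY, h⟩ := ih _ hη
    obtain ⟨c', hc', hc⟩ := Option.bind_eq_some_iff.1 hc
    obtain ⟨d', hd', hd⟩ := Option.bind_eq_some_iff.1 hd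
    obtain ⟨X', hX', hXX'⟩ := exists_derives_turn (hη ▸ hμγ) hX
    obtain ⟨Y', hY', hYY'⟩ := exists_derives_turn (hη ▸ hνγ) hY
    exact ⟨X', Y', c', d', hc', hd', hX', hY',
      derives_rule 26 (by decide) [s.toNat, u, v, X, Y, c, d, X', Y', c', d', a]
        (by simp [(state_lt _).le, (letter_lt _).le, toNat_le, hX.le, hY.le, hX'.le, hY'.le]) trivial
        ⟨h, hXX', hYY', derives_edge hc, derives_edge hd⟩⟩

theorem derives_goal_iff : patternProgram.Derives A.encode .goal [] ↔ A.HasPattern := by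
  refine ⟨meaning_of_derives, ?_⟩
  rintro ⟨s, u, v, γ, μ, ν, hu, hv, hμ, hν, hμγ, hνγ, ⟨z, hz, hz'⟩, z', hz''⟩
  obtain ⟨X, Y, c, d, hc, hd, hX, hY, h⟩ :=
    exists_derives_walk hu hv hμ hν hμγ hνγ γ [] (List.append_nil γ).symm
  obtain rfl : u = c := Option.some.inj hc
  obtain rfl : v = d := Option.some.inj hd
  rw [hX.eq_zero hμγ, hY.eq_zero hνγ] at h
  exact derives_rule 27 (by decide) [s.toNat, u, v] (by simp [(state_lt _).le, toNat_le]) trivial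
    ⟨h, derives_sep hz hz', derives_live hz''⟩

end Completeness

end EdgeDFA

/-- The machine decides that the goal fact is not derivable, that is, that there is no pattern. -/
theorem mainTheorem2 :
    DecidableInPolyTime EdgeDFA.encode (fun A : EdgeDFA => IsWheelerLanguage A.language) := by
  classical
  refine ⟨_, fun A => ?_,
    EdgeDFA.patternProgram.computableInPolyTime .goal rfl EdgeDFA.encode⟩
  rw [decide_eq_true_iff, EdgeDFA.derives_goal_iff]
  exact EdgeDFA.isWheelerLanguage_iff.symm
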